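/- Let $S^2$ carry the round metric of curvature $4\pi$ (total area $1$) with area element $\nu$; let $z$ be the stereographic coordinate on $S^2\setminus\{N\}$ and $w=1/z$, so that $\nu=\frac{i}{2\pi}\frac{dz\wedge d\bar z}{(1+|z|^2)^2}$ and $|dz|^2=2\pi(1+|z|^2)^2$. Let $k\ge 2$ be an integer and let $L$ be the holomorphic line bundle of degree $k$ over $S^2$, with its canonical holomorphic frames $\zeta_L$ over $S^2\setminus\{N\}$ and $\zeta_{L,S}$ over $S^2\setminus\{S\}$, related by $\zeta_L=w^k\zeta_{L,S}$. Let $H^{1,0}(L)$ be the space of holomorphic $L$-valued $(1,0)$-forms and $H^{0,1}(L^*)=\Omega^{0,1}(L^*)/D''\Omega^{0,0}(L^*)$. Then the forms $z^{j-1}\zeta_L\,dz$, $1\le j\le k-1$, are a basis $\beta$ of $H^{1,0}(L)$; the pairing $((\phi,\eta))=\int_{S^2} i\,\phi\wedge\eta$ descends to a bilinear pairing of $H^{1,0}(L)$ with $H^{0,1}(L^*)$; and $H^{0,1}(L^*)$ has a basis $\beta^*$ that is dual to $\beta$ under this pairing. For every smooth hermitian metric $H$ on $L$, each class in $H^{0,1}(L^*)$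 has exactly one $H$-antiholomorphic representative $\eta$, that is, one with $D'\eta=0$ for the $(1,0)$ part $D'$ of the Chern connection that $H$ induces on $L^*$. Write its $H$-dual as $\eta^{*H}=g\,\zeta_L\,dz$ (equivalently $\eta=\bar g\,\zeta_L^{*H}d\bar z$). Then for every $1\le j\le k-1$ the integral $$b_j=\int_{S^2}\frac{|\eta|_H^2}{g}\,w^{-j+1}\,\nu$$ converges absolutely and $b_j$ is the $j$-th coordinate of the class $[\eta]$ in the basis $\beta^*$ (where the integrand is $0$ at the zeros of $g$). In particular, the numbers $b_1,\dots,b_{k-1}$ depend only on the class $[\eta]$ and not on the metric $H$. -/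

import Mathlib

open MeasureTheory
open scoped ContDiff ComplexConjugate

noncomputable section

namespace SphereLine

/-! The sphere `S²` is covered by the stereographic coordinate `z` on `S² - {N}` and by the
coordinate `w = 1/z` on `S² - {S}`; each of them takes all complex values, and they overlap in
`z ≠ 0`, `w ≠ 0`. -/

/-- The Wirtinger derivative `∂f/∂z = (∂f/∂x - i ∂f/∂y) / 2`. -/
def wirt (f : ℂ → ℂ) (z : ℂ) : ℂ :=
  (fderiv ℝ f z 1 - Complex.I * fderiv ℝ f z Complex.I) / 2

/-- The Wirtinger derivative `∂f/∂z̄ = (∂f/∂x + i ∂f/∂y) / 2`. -/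
def wirtBar (f : ℂ → ℂ) (z : ℂ) : ℂ :=
  (fderiv ℝ f z 1 + Complex.I * fderiv ℝ f z Complex.I) / 2

/-- A holomorphic line bundle over `S²` with a holomorphic frame `e_N` over `S² - {N}` and a
holomorphic frame `e_S` over `S² - {S}`, recorded by its holomorphic gauge transformation:
`e_N = trans(w) e_S` on `S² - {S, N}`. -/
structure HolLine where
  trans : ℂ → ℂ
  holo : DifferentiableOn ℂ trans {0}ᶜ
  ne_zero : ∀ w, w ≠ 0 → trans w ≠ 0

/-- The trivial line bundle. -/
def trivialLine : HolLine where
  trans := fun _ => 1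
  holo := differentiableOn_const _
  ne_zero := fun _ _ => one_ne_zero

/-- The line bundle `L` of degree `k`, in the frames `e_N = ζ_L` and `e_S = ζ_{L,S}`, where
`ζ_L = w ^ k ζ_{L,S}`. -/
def lineOfDegree (k : ℕ) : HolLine where
  trans := fun w => w ^ k
  holo := (differentiable_id.pow k).differentiableOn
  ne_zero := fun _ h => pow_ne_zero k h

/-- The dual bundle, in the dual frames. -/
def HolLine.dual (E : HolLine) : HolLine where
  trans := fun w => (E.trans w)⁻¹
  holo := E.holo.inv E.ne_zero
  ne_zero := fun w h => inv_ne_zero (E.ne_zero w h)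

/-- The gauge transformation of `T^{1,0}`: from `z = 1/w` one has `dz = -w⁻² dw`. Its conjugate is
the gauge transformation of `T^{0,1}`. -/
def dzTrans (w : ℂ) : ℂ := -(w ^ 2)⁻¹

/-- `Ω^{p,q}(E)` for `p, q ∈ {0, 1}`: a smooth section is a pair of smooth coefficients
`(a_N, a_S)`, with respect to the frames `dz^p ∧ dz̄^q ⊗ e_N` and `dw^p ∧ dw̄^q ⊗ e_S`,
which define the same element of each fibre over the overlap. -/
def Form (p q : ℕ) (E : HolLine) : Submodule ℂ ((ℂ → ℂ) × (ℂ → ℂ)) where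
  carrier := {s | ContDiff ℝ ∞ s.1 ∧ ContDiff ℝ ∞ s.2 ∧
    ∀ w, w ≠ 0 → s.2 w = E.trans w * dzTrans w ^ p * conj (dzTrans w) ^ q * s.1 w⁻¹}
  add_mem' := by
    rintro s t ⟨h1, h2, h3⟩ ⟨k1, k2, k3⟩
    refine ⟨h1.add k1, h2.add k2, fun w hw => ?_⟩
    simp only [Prod.snd_add, Prod.fst_add, Pi.add_apply, h3 w hw, k3 w hw]
    ring
  zero_mem' := ⟨contDiff_const, contDiff_const, fun w _ => by simp⟩
  smul_mem' := by
    rintro c s ⟨h1, h2, h3⟩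
    refine ⟨h1.const_smul c, h2.const_smul c, fun w hw => ?_⟩
    simp only [Prod.smul_snd, Prod.smul_fst, Pi.smul_apply, smul_eq_mul, h3 w hw]
    ring

/-- The coefficient over `S² - {N}`, as a function of the coordinate `z`. -/
def coefN {p q : ℕ} {E : HolLine} (s : Form p q E) : ℂ → ℂ := s.1.1

/-- The coefficient over `S² - {S}`, as a function of the coordinate `w`. -/
def coefS {p q : ℕ} {E : HolLine} (s : Form p q E) : ℂ → ℂ := s.1.2

theorem contDiff_wirtBar {f : ℂ → ℂ} (hf : ContDiff ℝ ∞ f) : ContDiff ℝ ∞ (wirtBar f) := by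
  have h : ContDiff ℝ ∞ (fderiv ℝ f) := hf.fderiv_right (by simp)
  have h1 : ContDiff ℝ ∞ (fun z => fderiv ℝ f z 1) := h.clm_apply contDiff_const
  have h2 : ContDiff ℝ ∞ (fun z => fderiv ℝ f z Complex.I) := h.clm_apply contDiff_const
  exact (h1.add (contDiff_const.mul h2)).div_const 2

theorem wirtBar_congr {f g : ℂ → ℂ} {z : ℂ} (h : f =ᶠ[nhds z] g) : wirtBar f z = wirtBar g z := by
  simp only [wirtBar, h.fderiv_eq]

/-- The `∂̄`-derivative of `a(w) f(φ(w))` for holomorphic `a`, `φ`. -/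
theorem wirtBar_mul_comp {a φ f : ℂ → ℂ} {a' φ' w : ℂ} (ha : HasDerivAt a a' w)
    (hφ : HasDerivAt φ φ' w) (hf : DifferentiableAt ℝ f (φ w)) :
    wirtBar (fun v => a v * f (φ v)) w = a w * conj φ' * wirtBar f (φ w) := by
  have ha' := ha.hasFDerivAt.restrictScalars ℝ
  have hφ' := hφ.hasFDerivAt.restrictScalars ℝ
  have hc := hf.hasFDerivAt.comp w hφ'
  have h := (ha'.mul hc).fderiv
  have e : (fun v => a v * f (φ v)) = (fun v => a v * (f ∘ φ) v) := rfl
  have key : ∀ u : ℂ, fderiv ℝ f (φ w) u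
      = u.re * fderiv ℝ f (φ w) 1 + u.im * fderiv ℝ f (φ w) Complex.I := by
    intro u
    have hu : u = u.re • (1 : ℂ) + u.im • Complex.I := by
      simp [Complex.re_add_im]
    conv_lhs => rw [hu]
    rw [map_add, map_smul, map_smul]
    simp
  have hconj : conj φ' = φ'.re - φ'.im * Complex.I := by
    apply Complex.ext <;> simp
  have hI : (Complex.I * φ').re = -φ'.im ∧ (Complex.I * φ').im = φ'.re := by simp
  unfold wirtBar
  rw [e]
  have h1 : fderiv ℝ (fun v => a v * (f ∘ φ) v) w = _ := h
  rw [h1]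
  simp [key φ', key (Complex.I * φ'), hI.1, hI.2, hconj]
  linear_combination ((1 / 2) * a w * φ'.im * fderiv ℝ f (φ w) Complex.I
     + (1 / 2) * a' * f (φ w)) * Complex.I_sq

/-- The holomorphic structure `D'' : Ω^{p,0}(E) → Ω^{p,1}(E)`. In a holomorphic frame it sends
`a dz^p ⊗ e` to `(∂a/∂z̄) dz̄ ∧ dz^p ⊗ e = (-1)^p (∂a/∂z̄) dz^p ∧ dz̄ ⊗ e`. -/
def delbar (p : ℕ) (E : HolLine) : Form p 0 E →ₗ[ℂ] Form p 1 E where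
  toFun s := ⟨(fun z => (-1) ^ p * wirtBar (coefN s) z, fun w => (-1) ^ p * wirtBar (coefS s) w), by
    obtain ⟨⟨s1, s2⟩, h1, h2, h3⟩ := s
    refine ⟨contDiff_const.mul (contDiff_wirtBar h1), contDiff_const.mul (contDiff_wirtBar h2),
      fun w hw => ?_⟩
    have hd : HasDerivAt (fun v : ℂ => v⁻¹) (dzTrans w) w := by
      simpa [dzTrans] using hasDerivAt_inv hw
    have hopen : ({0}ᶜ : Set ℂ) ∈ nhds w := isOpen_compl_singleton.mem_nhds hw
    have hdz : DifferentiableAt ℂ dzTrans w := by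
      unfold dzTrans
      exact ((differentiableAt_id.pow 2).inv (pow_ne_zero 2 hw)).neg
    have ha : DifferentiableAt ℂ (fun v => E.trans v * dzTrans v ^ p) w :=
      (E.holo.differentiableAt hopen).mul (hdz.pow p)
    have hs : s2 =ᶠ[nhds w] fun v => (E.trans v * dzTrans v ^ p) * s1 v⁻¹ := by
      filter_upwards [hopen] with v hv
      have := h3 v hv
      simpa using this
    have hf : DifferentiableAt ℝ s1 w⁻¹ := (h1.differentiable (by simp)).differentiableAt
    have key := wirtBar_mul_comp ha.hasDerivAt hd hf
    simp only [coefN, coefS]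
    rw [wirtBar_congr hs, key]
    ring⟩
  map_add' s t := by
    obtain ⟨⟨s1, s2⟩, h1, h2, h3⟩ := s
    obtain ⟨⟨t1, t2⟩, k1, k2, k3⟩ := t
    have e : ∀ (f g : ℂ → ℂ) (z : ℂ), ContDiff ℝ ∞ f → ContDiff ℝ ∞ g →
        wirtBar (f + g) z = wirtBar f z + wirtBar g z := by
      intro f g z hf hg
      unfold wirtBar
      rw [fderiv_add (hf.differentiable (by simp)).differentiableAt
        (hg.differentiable (by simp)).differentiableAt]
      simp only [add_apply]
      ring
    apply Subtype.ext
    apply Prod.ext <;> funext z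
    · simp [coefN, e s1 t1 z h1 k1, mul_add]
    · simp [coefS, e s2 t2 z h2 k2, mul_add]
  map_smul' c s := by
    obtain ⟨⟨s1, s2⟩, h1, h2, h3⟩ := s
    have e : ∀ (f : ℂ → ℂ) (z : ℂ), ContDiff ℝ ∞ f → wirtBar (c • f) z = c * wirtBar f z := by
      intro f z hf
      unfold wirtBar
      rw [fderiv_const_smul (hf.differentiable (by simp)).differentiableAt]
      simp only [smul_apply, smul_eq_mul]
      ring
    apply Subtype.ext
    apply Prod.ext <;> funext z
    · simp [coefN, e s1 z h1, mul_left_comm]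
    · simp [coefS, e s2 z h2, mul_left_comm]

/-- `H^{1,0}(E)`: the `D''`-closed elements of `Ω^{1,0}(E)` (there is nothing to divide by). -/
abbrev H10 (E : HolLine) := LinearMap.ker (delbar 1 E)

/-- `H^{0,1}(E) = Ω^{0,1}(E) / D''(Ω^{0,0}(E))` (every element of `Ω^{0,1}(E)` is `D''`-closed,
because `Ω^{0,2} = 0` on a Riemann surface). -/
abbrev H01 (E : HolLine) := Form 0 1 E ⧸ LinearMap.range (delbar 0 E)

/-- The class in `H^{0,1}(E)` of a form `η ∈ Ω^{0,1}(E)`. -/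
def cls {E : HolLine} (η : Form 0 1 E) : H01 E := (LinearMap.range (delbar 0 E)).mkQ η

/-- The wedge product `Ω^{1,0}(E) × Ω^{0,1}(E*) → Ω²(ℂ)`,
`(a dz ⊗ e) ∧ (b dz̄ ⊗ e*) = a b dz ∧ dz̄`. -/
def wedge {E : HolLine} (φ : Form 1 0 E) (η : Form 0 1 E.dual) : Form 1 1 trivialLine :=
  ⟨(fun z => coefN φ z * coefN η z, fun w => coefS φ w * coefS η w), by
    obtain ⟨⟨s1, s2⟩, h1, h2, h3⟩ := φ
    obtain ⟨⟨t1, t2⟩, k1, k2, k3⟩ := η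
    refine ⟨h1.mul k1, h2.mul k2, fun w hw => ?_⟩
    have := E.ne_zero w hw
    have e1 := h3 w hw
    have e2 := k3 w hw
    simp only at e1 e2
    simp only [coefN, coefS, e1, e2, HolLine.dual, trivialLine]
    field_simp⟩

/-- The integral over `S²` of a complex 2-form `a dz ∧ dz̄ = -2i a dx ∧ dy`; the point `N` is
negligible. -/
def integralTwoForm (α : Form 1 1 trivialLine) : ℂ := ∫ z : ℂ, -2 * Complex.I * coefN α z

/-- The coupling `((φ, η)) = ∫ i φ ∧ η` of `Ω^{1,0}(E)` and `Ω^{0,1}(E*)`. -/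
def coupling {E : HolLine} (φ : Form 1 0 E) (η : Form 0 1 E.dual) : ℂ :=
  integralTwoForm (Complex.I • wedge φ η)

/-- A smooth hermitian metric `H` on `E`, recorded by `|e_N|_H²` and `|e_S|_H²`. -/
structure HermMetric (E : HolLine) where
  hN : ℂ → ℝ
  hS : ℂ → ℝ
  smoothN : ContDiff ℝ ∞ hN
  smoothS : ContDiff ℝ ∞ hS
  posN : ∀ z, 0 < hN z
  posS : ∀ w, 0 < hS w
  compat : ∀ w, w ≠ 0 → hN w⁻¹ = ‖E.trans w‖ ^ 2 * hS w

/-- The metric on the dual bundle. -/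
def HermMetric.dual {E : HolLine} (H : HermMetric E) : HermMetric E.dual where
  hN := fun z => (H.hN z)⁻¹
  hS := fun w => (H.hS w)⁻¹
  smoothN := H.smoothN.inv fun z => (H.posN z).ne'
  smoothS := H.smoothS.inv fun w => (H.posS w).ne'
  posN := fun z => inv_pos.2 (H.posN z)
  posS := fun w => inv_pos.2 (H.posS w)
  compat := fun w hw => by simp [H.compat w hw, HolLine.dual, mul_inv_rev, mul_comm]

/-- The `(1,0)` part of the Chern connection in a holomorphic frame `e` with `|e|_H² = h`:
`D'(a dz̄ ⊗ e) = (∂a/∂z + a ∂(log h)/∂z) dz ∧ dz̄ ⊗ e`; this is its coefficient. -/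
def chernCoef (h : ℂ → ℝ) (a : ℂ → ℂ) (z : ℂ) : ℂ :=
  wirt a z + a z * wirt (fun v => (Real.log (h v) : ℂ)) z

/-- `η ∈ Ω^{0,1}(E)` is antiholomorphic for the metric `H` on `E`: `D'η = 0`. -/
def IsAntiholomorphic {E : HolLine} (H : HermMetric E) (η : Form 0 1 E) : Prop :=
  (∀ z, chernCoef H.hN (coefN η) z = 0) ∧ ∀ w, chernCoef H.hS (coefS η) w = 0

/-- The `H`-dual `η^{*H} ∈ Ω^{1,0}(E)` of `η ∈ Ω^{0,1}(E*)`: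
`(a dz̄ ⊗ e*)^{*H} = ā |e*|_H² dz ⊗ e`. -/
def hDual {E : HolLine} (H : HermMetric E) (η : Form 0 1 E.dual) : Form 1 0 E :=
  ⟨(fun z => conj (coefN η z) * (H.dual.hN z : ℂ), fun w => conj (coefS η w) * (H.dual.hS w : ℂ)), by
    obtain ⟨⟨t1, t2⟩, k1, k2, k3⟩ := η
    refine ⟨(Complex.conjCLE.contDiff.comp k1).mul
        (Complex.ofRealCLM.contDiff.comp H.dual.smoothN),
      (Complex.conjCLE.contDiff.comp k2).mul
        (Complex.ofRealCLM.contDiff.comp H.dual.smoothS), fun w hw => ?_⟩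
    have h0 := E.ne_zero w hw
    have h0' : conj (E.trans w) ≠ 0 := (map_ne_zero _).2 h0
    have hS : (H.hS w : ℂ) ≠ 0 := by exact_mod_cast (H.posS w).ne'
    have e2 := k3 w hw
    simp only at e2
    have hc : (H.hN w⁻¹ : ℂ) = E.trans w * conj (E.trans w) * H.hS w := by
      rw [H.compat w hw, Complex.mul_conj, Complex.normSq_eq_norm_sq]
      push_cast
      ring
    simp only [coefN, coefS, e2, HolLine.dual, HermMetric.dual, Complex.ofReal_inv, hc, map_mul,
      map_inv₀, Complex.conj_conj, pow_zero, pow_one, mul_one]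
    field_simp⟩

/-- The conformal factor `ρ` of the round metric `ρ (dx² + dy²)` of curvature `4π` and total
area 1. -/
def roundFactor (z : ℂ) : ℝ := 1 / (Real.pi * (1 + ‖z‖ ^ 2) ^ 2)

/-- The area measure `ν = ρ dx dy` in the coordinate `z`. -/
def areaMeasure : Measure ℂ := volume.withDensity fun z => ENNReal.ofReal (roundFactor z)

/-- `|dz|² = |dz̄|² = |dx|² + |dy|² = 2 / ρ` for the round metric. -/
def normSqDz (z : ℂ) : ℝ := 2 / roundFactor z

/-- The pointwise norm `|η|_H² = |a|² |e*|_H² |dz̄|²` of `η = a dz̄ ⊗ e*`, at the point with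
coordinate `z`. -/
def normSq {E : HolLine} (H : HermMetric E) (η : Form 0 1 E.dual) (z : ℂ) : ℝ :=
  ‖coefN η z‖ ^ 2 * H.dual.hN z * normSqDz z

/-- The function `(|η|_H² / g) w^{-j+1}` on `S² - {N}`, where `w = 1/z` and `g` is defined by
`η^{*H} = g ζ_L dz`, equivalently `η = ḡ ζ_L^{*H} dz̄`. -/
def bIntegrand {E : HolLine} (H : HermMetric E) (η : Form 0 1 E.dual) (j : ℕ) (z : ℂ) : ℂ :=
  (normSq H η z : ℂ) / coefN (hDual H η) z * (z⁻¹) ^ (-(j : ℤ) + 1)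

/-- The coefficient `b_j = ∫ (|η|_H² / g) w^{-j+1} ν`. -/
def bCoeff {E : HolLine} (H : HermMetric E) (η : Form 0 1 E.dual) (j : ℕ) : ℂ :=
  ∫ z, bIntegrand H η j z ∂areaMeasure

end SphereLine

end

open SphereLine

open MeasureTheory Filter Topology
open scoped ContDiff ComplexConjugate

namespace SphereLine

/-! ### Wirtinger derivatives -/

/-! Write `η = a dz̄ ⊗ e*` and `h = |ζ_L|²`. Then `|η|² = 2|a|²/(hρ)` and `g = ā/h`, so the metric
and the round factor cancel: `(|η|²/g) w^{-j+1} ν = 2 z^{j-1} a dx dy`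
(`roundFactor_smul_bIntegrand`). Thus `b_j` is the coupling of `z^{j-1} ζ_L dz` with `η`. By Stokes
(`coupling_delbar`) it depends only on the class, and in a dual basis it is a coordinate.

What remains is duality, obtained without elliptic theory. Holomorphic forms have polynomial
coefficients of degree at most `k - 2`, by Liouville, which gives `β`. A class that couples to zero
with every monomial is exact: a representative supported away from `N` is integrated by the Cauchy
transform, and the vanishing moments make this solution extend over `N` as a section of `L*`
(`eq_zero_of_couplingClasses_eq_zero`). Hence `H^{0,1}(L*)` embeds in `ℂ^{k-1}`.

Conversely, a form is antiholomorphic exactly when its `H`-dual is holomorphic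
(`isAntiholomorphic_iff`). Sending a holomorphic `φ` to the class of the form with `H`-dual `φ` is
antilinear, and injective because `φ` couples with its image to `2∫|φ|²h`. Counting real dimensions
makes both injections bijective (`bijective_of_pairing`); this yields the dual basis and the unique
antiholomorphic representatives together. -/

theorem wirtBar_eq_zero_of_differentiableAt {f : ℂ → ℂ} {z : ℂ} (h : DifferentiableAt ℂ f z) :
    wirtBar f z = 0 := by
  have := (differentiableAt_complex_iff_differentiableAt_real.1 h).2
  rw [wirtBar, this, smul_eq_mul, ← mul_assoc, Complex.I_mul_I]
  ring

theorem differentiableAt_of_wirtBar_eq_zero {f : ℂ → ℂ} {z : ℂ} (hf : DifferentiableAt ℝ f z)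
    (h : wirtBar f z = 0) : DifferentiableAt ℂ f z := by
  refine differentiableAt_complex_iff_differentiableAt_real.2 ⟨hf, ?_⟩
  rw [wirtBar, div_eq_zero_iff, or_iff_left two_ne_zero] at h
  rw [smul_eq_mul]
  linear_combination -Complex.I * h + fderiv ℝ f z Complex.I * Complex.I_sq

theorem fderiv_real_apply (f : ℂ → ℂ) (z u : ℂ) :
    fderiv ℝ f z u = u.re * fderiv ℝ f z 1 + u.im * fderiv ℝ f z Complex.I := by
  have hu : u = u.re • (1 : ℂ) + u.im • Complex.I := by simp [Complex.re_add_im]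
  conv_lhs => rw [hu]
  rw [map_add, map_smul, map_smul]
  simp

theorem wirtBar_mul_of_differentiableAt {a f : ℂ → ℂ} {z : ℂ} (ha : DifferentiableAt ℂ a z)
    (hf : DifferentiableAt ℝ f z) : wirtBar (fun v => a v * f v) z = a z * wirtBar f z := by
  simpa using wirtBar_mul_comp (φ := id) ha.hasDerivAt (hasDerivAt_id z) hf

/-! ### The Cauchy kernel -/

/-- In polar coordinates the Jacobian `r` cancels `|z|⁻¹`, leaving the area of a bounded rectangle.
-/
theorem lintegral_enorm_inv_ball_lt_top (R : ℝ) :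
    ∫⁻ z in Metric.ball (0 : ℂ) R, ‖z⁻¹‖ₑ < ⊤ := by
  rw [← lintegral_indicator Metric.isOpen_ball.measurableSet,
    ← Complex.lintegral_comp_polarCoord_symm]
  calc _ ≤ ∫⁻ p in polarCoord.target,
        (Set.Ioo 0 R ×ˢ Set.Ioo (-Real.pi) Real.pi).indicator (fun _ => 1) p := by
        refine setLIntegral_mono' polarCoord.open_target.measurableSet fun p hp => ?_
        have hp1 : 0 < p.1 := hp.1
        have hp2 : p.2 ∈ Set.Ioo (-Real.pi) Real.pi := hp.2
        have hn : ‖Complex.polarCoord.symm p‖ = p.1 := by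
          rw [Complex.norm_polarCoord_symm, abs_of_pos hp1]
        by_cases h : p.1 < R
        · have hmem : p ∈ Set.Ioo 0 R ×ˢ Set.Ioo (-Real.pi) Real.pi := ⟨⟨hp1, h⟩, hp2⟩
          rw [Set.indicator_of_mem (by rwa [mem_ball_zero_iff, hn]), Set.indicator_of_mem hmem,
            ← ofReal_norm, norm_inv, hn, smul_eq_mul, ← ENNReal.ofReal_mul hp1.le,
            mul_inv_cancel₀ hp1.ne', ENNReal.ofReal_one]
        · rw [Set.indicator_of_notMem (by rwa [mem_ball_zero_iff, hn])]
          simp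
    _ ≤ ∫⁻ p, (Set.Ioo 0 R ×ˢ Set.Ioo (-Real.pi) Real.pi).indicator (fun _ => 1) p :=
        setLIntegral_le_lintegral _ _
    _ < ⊤ := by
        rw [lintegral_indicator (measurableSet_Ioo.prod measurableSet_Ioo)]
        simp only [lintegral_const, one_mul, Measure.restrict_apply_univ, Measure.volume_eq_prod,
          Measure.prod_prod, Real.volume_Ioo]
        exact ENNReal.mul_lt_top ENNReal.ofReal_lt_top ENNReal.ofReal_lt_top

theorem locallyIntegrable_inv : LocallyIntegrable (fun z : ℂ => z⁻¹) := by
  intro z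
  refine ⟨Metric.ball 0 (‖z‖ + 1), Metric.isOpen_ball.mem_nhds (by simp), ?_⟩
  exact ⟨by fun_prop, lintegral_enorm_inv_ball_lt_top _⟩

/-- The derivative of `b(r e^{iθ})` in polar coordinates. -/
theorem hasFDerivAt_polar {b : ℂ → ℂ} (hb : Differentiable ℝ b) (r θ : ℝ) :
    HasDerivAt (fun s : ℝ => b (s * (Real.cos θ + Real.sin θ * Complex.I)))
      (Real.cos θ * fderiv ℝ b (r * (Real.cos θ + Real.sin θ * Complex.I)) 1 +
        Real.sin θ * fderiv ℝ b (r * (Real.cos θ + Real.sin θ * Complex.I)) Complex.I) r ∧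
    HasDerivAt (fun t : ℝ => b (r * (Real.cos t + Real.sin t * Complex.I)))
      (r * (-Real.sin θ * fderiv ℝ b (r * (Real.cos θ + Real.sin θ * Complex.I)) 1 +
        Real.cos θ * fderiv ℝ b (r * (Real.cos θ + Real.sin θ * Complex.I)) Complex.I)) θ := by
  have hd := (hb (r * (Real.cos θ + Real.sin θ * Complex.I))).hasFDerivAt
  constructor
  · have h1 : HasDerivAt (fun s : ℝ => (s : ℂ) * (Real.cos θ + Real.sin θ * Complex.I))
        (1 * (Real.cos θ + Real.sin θ * Complex.I)) r :=
      (Complex.ofRealCLM.hasDerivAt (x := r)).mul_const _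
    have h2 := hd.comp_hasDerivAt r h1
    rw [fderiv_real_apply] at h2
    simpa [Function.comp_def] using h2
  · have h1 : HasDerivAt (fun t : ℝ => (r : ℂ) * (Real.cos t + Real.sin t * Complex.I))
        (r * (((-Real.sin θ : ℝ) : ℂ) + (Real.cos θ : ℝ) * Complex.I)) θ :=
      (((Real.hasDerivAt_cos θ).ofReal_comp).add
        (((Real.hasDerivAt_sin θ).ofReal_comp).mul_const _)).const_mul _
    have h2 := hd.comp_hasDerivAt θ h1
    rw [fderiv_real_apply] at h2
    convert! h2 using 1
    simp
    ring

/-- This says that `1/(πz)` is a fundamental solution of `∂/∂z̄`. In polar coordinates `r z⁻¹ ∂b/∂z̄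
= (1/2) ∂b/∂r + (i/2) r⁻¹ ∂b/∂θ`; the radial term gives `-b(0)` along each ray, and the angular term
vanishes by periodicity. -/
theorem integral_wirtBar_mul_inv {b : ℂ → ℂ} (hb : ContDiff ℝ ∞ b) (hc : HasCompactSupport b) :
    ∫ z, z⁻¹ * wirtBar b z = -Real.pi * b 0 := by
  have hd : Differentiable ℝ b := hb.differentiable (by simp)
  obtain ⟨R, hR⟩ : ∃ R : ℝ, ∀ z, R ≤ ‖z‖ → fderiv ℝ b z = 0 ∧ b z = 0 := by
    obtain ⟨R, hR⟩ := hc.isCompact.isBounded.subset_ball 0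
    refine ⟨R, fun z hz => ?_⟩
    have hz' : z ∉ tsupport b := fun h => by
      have := hR h
      simp at this
      linarith
    exact ⟨fderiv_of_notMem_tsupport ℝ hz', image_eq_zero_of_notMem_tsupport hz'⟩
  have hcf : Continuous (fderiv ℝ b) := hb.continuous_fderiv (by simp)
  set e : ℝ × ℝ → ℂ := fun p => p.1 * (Real.cos p.2 + Real.sin p.2 * Complex.I) with he
  have hec : Continuous e := by fun_prop
  have hen : ∀ p, ‖e p‖ = |p.1| := fun p => by
    rw [← Complex.norm_polarCoord_symm, Complex.polarCoord_symm_apply]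
  -- `Fr` is `∂b/∂r`, and `Ft` is `r⁻¹ ∂b/∂θ` with the factor `r` already cancelled, so both are
  -- continuous across `r = 0`.
  set Fr : ℝ × ℝ → ℂ := fun p => Real.cos p.2 * fderiv ℝ b (e p) 1 +
    Real.sin p.2 * fderiv ℝ b (e p) Complex.I with hFr
  set Ft : ℝ × ℝ → ℂ := fun p => -Real.sin p.2 * fderiv ℝ b (e p) 1 +
    Real.cos p.2 * fderiv ℝ b (e p) Complex.I with hFt
  have hFrc : Continuous Fr := by fun_prop
  have hFtc : Continuous Ft := by fun_prop
  have hint : ∀ F : ℝ × ℝ → ℂ, Continuous F → (∀ p, R ≤ p.1 → 0 < p.1 → F p = 0) →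
      IntegrableOn F (Set.Ioi (0 : ℝ) ×ˢ Set.Ioo (-Real.pi) Real.pi) := by
    intro F hF h0
    have h1 : IntegrableOn F (Set.Icc (0 : ℝ) R ×ˢ Set.Icc (-Real.pi) Real.pi) :=
      hF.continuousOn.integrableOn_compact (isCompact_Icc.prod isCompact_Icc)
    refine h1.of_forall_sdiff_eq_zero (measurableSet_Ioi.prod measurableSet_Ioo) ?_
    rintro p ⟨⟨hp1, hp2⟩, hp3⟩
    refine h0 p ?_ hp1
    by_contra hlt
    exact hp3 ⟨⟨le_of_lt hp1, (not_le.1 hlt).le⟩, Set.Ioo_subset_Icc_self hp2⟩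
  have hzero : ∀ p : ℝ × ℝ, R ≤ p.1 → 0 < p.1 → fderiv ℝ b (e p) = 0 := fun p h1 h2 =>
    (hR _ (by rw [hen, abs_of_pos h2]; exact h1)).1
  have hFri := hint Fr hFrc fun p h1 h2 => by simp [hFr, hzero p h1 h2]
  have hFti := hint Ft hFtc fun p h1 h2 => by simp [hFt, hzero p h1 h2]
  have hIr : ∫ p in Set.Ioi (0 : ℝ) ×ˢ Set.Ioo (-Real.pi) Real.pi, Fr p = -(2 * Real.pi) * b 0 := by
    rw [Measure.volume_eq_prod] at hFri ⊢
    rw [IntegrableOn, ← Measure.prod_restrict] at hFri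
    rw [← Measure.prod_restrict, integral_prod_symm _ hFri]
    have : ∀ θ : ℝ, ∫ r in Set.Ioi (0 : ℝ), Fr (r, θ) = - b 0 := by
      intro θ
      have hcomp : IntegrableOn (fun r => Fr (r, θ)) (Set.Ioi (0 : ℝ)) := by
        have h1 : IntegrableOn (fun r => Fr (r, θ)) (Set.Icc (0 : ℝ) R) :=
          (hFrc.comp (by fun_prop : Continuous fun r : ℝ => (r, θ))).continuousOn.integrableOn_compact
            isCompact_Icc
        refine h1.of_forall_sdiff_eq_zero measurableSet_Ioi ?_
        rintro r ⟨hp1, hp3⟩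
        have : R ≤ r := by
          by_contra hlt
          exact hp3 ⟨le_of_lt hp1, (not_le.1 hlt).le⟩
        simp [hFr, hzero (r, θ) this hp1]
      have := integral_Ioi_of_hasDerivAt_of_tendsto' (a := (0 : ℝ)) (m := (0 : ℂ))
        (f := fun s : ℝ => b (s * (Real.cos θ + Real.sin θ * Complex.I)))
        (fun r _ => (hasFDerivAt_polar hd r θ).1) hcomp ?_
      · refine Eq.trans this ?_
        simp
      · refine tendsto_const_nhds.congr' ?_
        filter_upwards [eventually_ge_atTop R, eventually_gt_atTop 0] with r h1 h2
        exact ((hR (e (r, θ)) (by rw [hen, abs_of_pos h2]; exact h1)).2).symm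
    simp only [this]
    simp only [integral_const, Measure.real, Measure.restrict_apply_univ, Real.volume_Ioo]
    rw [ENNReal.toReal_ofReal (by linarith [Real.pi_pos])]
    rw [Complex.real_smul]
    push_cast
    ring
  have hIt : ∫ p in Set.Ioi (0 : ℝ) ×ˢ Set.Ioo (-Real.pi) Real.pi, Ft p = 0 := by
    rw [Measure.volume_eq_prod] at hFti ⊢
    rw [setIntegral_prod _ hFti]
    refine setIntegral_eq_zero_of_forall_eq_zero fun r hr => ?_
    have hr0 : (r : ℂ) ≠ 0 := by exact_mod_cast (ne_of_gt hr)
    rw [← integral_Ioc_eq_integral_Ioo,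
      ← intervalIntegral.integral_of_le (by linarith [Real.pi_pos])]
    have hcont : Continuous fun t : ℝ => (r : ℂ) * Ft (r, t) :=
      continuous_const.mul (hFtc.comp (by fun_prop : Continuous fun t : ℝ => (r, t)))
    have hder : ∀ θ : ℝ, HasDerivAt (fun t : ℝ => b (e (r, t))) ((r : ℂ) * Ft (r, θ)) θ :=
      fun θ => (hasFDerivAt_polar hd r θ).2
    have hper : e (r, Real.pi) = e (r, -Real.pi) := by simp [he]
    have h2 : (r : ℂ) * ∫ θ in (-Real.pi)..Real.pi, Ft (r, θ) = 0 := by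
      rw [← intervalIntegral.integral_const_mul,
        intervalIntegral.integral_eq_sub_of_hasDerivAt (fun θ _ => hder θ)
          (hcont.intervalIntegrable _ _), hper, sub_self]
    exact (mul_eq_zero.1 h2).resolve_left hr0
  rw [← Complex.integral_comp_polarCoord_symm]
  have hpt : ∀ p ∈ polarCoord.target, p.1 • ((Complex.polarCoord.symm p)⁻¹ *
      wirtBar b (Complex.polarCoord.symm p)) = (1 / 2) * Fr p + (Complex.I / 2) * Ft p := by
    intro p hp
    have hp1 : (p.1 : ℂ) ≠ 0 := by exact_mod_cast (ne_of_gt hp.1)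
    have hu : ((Real.cos p.2 : ℂ) + Real.sin p.2 * Complex.I) *
        (Real.cos p.2 - Real.sin p.2 * Complex.I) = 1 := by
      have : ((Real.cos p.2 : ℂ)) ^ 2 + (Real.sin p.2 : ℂ) ^ 2 = 1 := by
        exact_mod_cast Real.cos_sq_add_sin_sq p.2
      linear_combination this - (Real.sin p.2 : ℂ) ^ 2 * Complex.I_sq
    rw [Complex.polarCoord_symm_apply, mul_inv, inv_eq_of_mul_eq_one_right hu, Complex.real_smul,
      ← mul_assoc, ← mul_assoc, mul_inv_cancel₀ hp1, one_mul]
    simp only [hFr, hFt, wirtBar, he]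
    linear_combination (-(Real.sin p.2 : ℂ) *
      fderiv ℝ b (p.1 * (Real.cos p.2 + Real.sin p.2 * Complex.I)) Complex.I / 2) * Complex.I_sq
  rw [setIntegral_congr_fun polarCoord.open_target.measurableSet hpt]
  change ∫ p in Set.Ioi (0 : ℝ) ×ˢ Set.Ioo (-Real.pi) Real.pi, _ = _
  rw [integral_add (hFri.const_mul _) (hFti.const_mul _), integral_const_mul, integral_const_mul,
    hIr, hIt]
  ring

/-! ### The Cauchy transform -/

/-- The Cauchy transform `(1/π) ∫ a(ζ) / (z - ζ)`, a solution of `∂u/∂z̄ = a`. -/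
noncomputable def cauchyTransform (a : ℂ → ℂ) (z : ℂ) : ℂ :=
  (Real.pi : ℂ)⁻¹ * ∫ ζ, ζ⁻¹ * a (z - ζ)

theorem cauchyTransform_eq_convolution (a : ℂ → ℂ) : cauchyTransform a = fun z =>
    (Real.pi : ℂ)⁻¹ *
      convolution (fun ζ : ℂ => ζ⁻¹) a (ContinuousLinearMap.mul ℝ ℂ) volume z := by
  funext z
  simp [cauchyTransform, convolution]

theorem contDiff_cauchyTransform {a : ℂ → ℂ} (ha : ContDiff ℝ ∞ a) (hc : HasCompactSupport a) :
    ContDiff ℝ ∞ (cauchyTransform a) := by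
  rw [cauchyTransform_eq_convolution]
  exact contDiff_const.mul (hc.contDiff_convolution_right _ locallyIntegrable_inv ha)

/-- Derivatives of the convolution fall on `a`. Then `integral_wirtBar_mul_inv` applies to `ζ ↦ a(z
- ζ)`, and the reflection supplies the sign that cancels the one in `-π`. -/
theorem wirtBar_cauchyTransform {a : ℂ → ℂ} (ha : ContDiff ℝ ∞ a) (hc : HasCompactSupport a)
    (z : ℂ) : wirtBar (cauchyTransform a) z = a z := by
  have hd := (hc.hasFDerivAt_convolution_right (ContinuousLinearMap.mul ℝ ℂ)
    locallyIntegrable_inv (ha.of_le (by simp)) z).const_mul (Real.pi : ℂ)⁻¹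
  have hca : Continuous (fderiv ℝ a) := ha.continuous_fderiv (by simp)
  have hu : ∀ u : ℂ, fderiv ℝ (cauchyTransform a) z u =
      (Real.pi : ℂ)⁻¹ * ∫ ζ, ζ⁻¹ * fderiv ℝ a (z - ζ) u := by
    intro u
    rw [cauchyTransform_eq_convolution, hd.fderiv]
    simp only [smul_apply, smul_eq_mul]
    rw [convolution_precompR_apply _ locallyIntegrable_inv (hc.fderiv ℝ) hca]
    simp [convolution]
  have hint : ∀ u : ℂ, Integrable fun ζ => ζ⁻¹ * fderiv ℝ a (z - ζ) u := by
    intro u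
    have hcu : HasCompactSupport fun x => fderiv ℝ a x u := hc.fderiv_apply (𝕜 := ℝ) u
    have := hcu.convolutionExists_right (ContinuousLinearMap.mul ℝ ℂ) locallyIntegrable_inv
      (hca.clm_apply continuous_const) z
    simpa [ConvolutionExistsAt] using this
  set b : ℂ → ℂ := fun ζ => a (z - ζ) with hb
  have hbd : ContDiff ℝ ∞ b := ha.comp (contDiff_const.sub contDiff_id)
  have hbc : HasCompactSupport b := hc.comp_homeomorph (Homeomorph.subLeft z)
  have hbf : ∀ ζ u, fderiv ℝ b ζ u = - fderiv ℝ a (z - ζ) u := by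
    intro ζ u
    have h1 : HasFDerivAt (fun ζ : ℂ => z - ζ) (-ContinuousLinearMap.id ℝ ℂ) ζ :=
      (hasFDerivAt_id ζ).const_sub z
    have h2 := ((ha.differentiable (by simp)) (z - ζ)).hasFDerivAt.comp ζ h1
    have h3 : fderiv ℝ b ζ = _ := h2.fderiv
    rw [h3]
    simp
  have key := integral_wirtBar_mul_inv hbd hbc
  have hpi : (Real.pi : ℂ) ≠ 0 := by exact_mod_cast Real.pi_ne_zero
  have hw : ∀ ζ, ζ⁻¹ * wirtBar b ζ = (-1 / 2) * (ζ⁻¹ * fderiv ℝ a (z - ζ) 1) +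
      (-Complex.I / 2) * (ζ⁻¹ * fderiv ℝ a (z - ζ) Complex.I) := by
    intro ζ
    rw [wirtBar, hbf, hbf]
    ring
  simp only [hw] at key
  rw [integral_add ((hint 1).const_mul _) ((hint Complex.I).const_mul _), integral_const_mul,
    integral_const_mul] at key
  have hb0 : b 0 = a z := by simp [hb]
  rw [hb0] at key
  rw [wirtBar, hu, hu]
  have hpi' : (Real.pi : ℂ)⁻¹ * Real.pi = 1 := inv_mul_cancel₀ hpi
  linear_combination (-(Real.pi : ℂ)⁻¹) * key + a z * hpi'

theorem cauchyTransform_eq (a : ℂ → ℂ) (z : ℂ) :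
    cauchyTransform a z = (Real.pi : ℂ)⁻¹ * ∫ ζ, (z - ζ)⁻¹ * a ζ := by
  rw [cauchyTransform, ← integral_sub_left_eq_self (fun ζ => ζ⁻¹ * a (z - ζ)) volume z]
  simp

/-- If the first moments of `a` vanish, then its Cauchy transform decays at infinity. -/
theorem tendsto_pow_mul_cauchyTransform {a : ℂ → ℂ} (ha : Continuous a)
    (hc : HasCompactSupport a) (m : ℕ) (hm : ∀ j < m, ∫ ζ, ζ ^ j * a ζ = 0) :
    Tendsto (fun z => z ^ m * cauchyTransform a z) (cocompact ℂ) (𝓝 0) := by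
  obtain ⟨R, hR⟩ : ∃ R : ℝ, ∀ z, R ≤ ‖z‖ → a z = 0 := by
    obtain ⟨R, hR⟩ := hc.isCompact.isBounded.subset_ball 0
    refine ⟨R, fun z hz => image_eq_zero_of_notMem_tsupport fun h => ?_⟩
    have := hR h
    simp at this
    linarith
  have hpow : ∀ j : ℕ, Integrable fun ζ => ζ ^ j * a ζ := fun j =>
    ((continuous_id.pow j).mul ha).integrable_of_hasCompactSupport hc.mul_left
  have hmain : ∀ z : ℂ, R < ‖z‖ →
      ‖z ^ m * cauchyTransform a z‖ ≤
        Real.pi⁻¹ * ((‖z‖ - R)⁻¹ * ∫ ζ, ‖ζ ^ m * a ζ‖) := by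
    intro z hz
    have hbound : ∀ ζ, ‖(z - ζ)⁻¹ * (ζ ^ m * a ζ)‖ ≤ (‖z‖ - R)⁻¹ * ‖ζ ^ m * a ζ‖ := by
      intro ζ
      rw [norm_mul, norm_inv]
      by_cases h : R ≤ ‖ζ‖
      · simp [hR ζ h]
      · have := norm_sub_norm_le z ζ
        push Not at h
        gcongr
        · linarith
    -- Finite geometric expansion of `z^m/(z - ζ)`: the moments annihilate the polynomial part, and
    -- the remainder is of order `1/|z|`.
    have hsum : ∀ ζ, z ^ m * ((z - ζ)⁻¹ * a ζ) =
        ∑ j ∈ Finset.range m, z ^ (m - 1 - j) * (ζ ^ j * a ζ) + (z - ζ)⁻¹ * (ζ ^ m * a ζ) := by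
      intro ζ
      by_cases h : R ≤ ‖ζ‖
      · simp [hR ζ h]
      · have hne : z - ζ ≠ 0 := fun h0 => by
          rw [sub_eq_zero.1 h0] at hz
          exact h hz.le
        have hg := (Commute.all z ζ).geom_sum₂_mul m
        have hg' : (∑ j ∈ Finset.range m, z ^ (m - 1 - j) * ζ ^ j) * (z - ζ) = z ^ m - ζ ^ m := by
          have := (Commute.all ζ z).geom_sum₂_mul m
          have e : ∑ j ∈ Finset.range m, z ^ (m - 1 - j) * ζ ^ j =
            ∑ j ∈ Finset.range m, ζ ^ j * z ^ (m - 1 - j) :=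
            Finset.sum_congr rfl fun j _ => mul_comm _ _
          rw [e]
          linear_combination -this
        simp only [← mul_assoc]
        rw [← Finset.sum_mul]
        field_simp
        linear_combination (-a ζ) * hg'
    have hint : Integrable fun ζ => (z - ζ)⁻¹ * (ζ ^ m * a ζ) := by
      refine ((hpow m).norm.const_mul (‖z‖ - R)⁻¹).mono' ?_ (ae_of_all _ hbound)
      exact (by fun_prop : Measurable fun ζ : ℂ => (z - ζ)⁻¹).aestronglyMeasurable.mul
        (hpow m).aestronglyMeasurable
    have hexp : z ^ m * cauchyTransform a z =
        (Real.pi : ℂ)⁻¹ * ∫ ζ, (z - ζ)⁻¹ * (ζ ^ m * a ζ) := by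
      rw [cauchyTransform_eq, mul_left_comm, ← integral_const_mul]
      simp only [hsum]
      rw [integral_add (integrable_finsetSum _ fun j _ => (hpow j).const_mul _) hint,
        integral_finsetSum _ fun j _ => (hpow j).const_mul _]
      rw [Finset.sum_eq_zero, zero_add]
      intro j hj
      rw [integral_const_mul, hm j (Finset.mem_range.1 hj), mul_zero]
    rw [hexp, norm_mul, norm_inv, Complex.norm_real, Real.norm_of_nonneg Real.pi_pos.le]
    gcongr
    rw [← integral_const_mul]
    exact norm_integral_le_of_norm_le ((hpow m).norm.const_mul _) (ae_of_all _ hbound)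
  rw [tendsto_zero_iff_norm_tendsto_zero]
  have hlim : Tendsto (fun z : ℂ => Real.pi⁻¹ * ((‖z‖ - R)⁻¹ * ∫ ζ, ‖ζ ^ m * a ζ‖))
      (cocompact ℂ) (𝓝 (Real.pi⁻¹ * (0 * ∫ ζ, ‖ζ ^ m * a ζ‖))) := by
    refine (Tendsto.mul_const _ ?_).const_mul _
    exact tendsto_inv_atTop_zero.comp
      (tendsto_atTop_add_const_right _ (-R) (tendsto_norm_cocompact_atTop (E := ℂ)))
  rw [zero_mul, mul_zero] at hlim
  refine squeeze_zero' (Eventually.of_forall fun _ => norm_nonneg _) ?_ hlim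
  filter_upwards [(tendsto_norm_cocompact_atTop (E := ℂ)).eventually_gt_atTop R] with z hz
  exact hmain z hz

/-! ### Forms on the sphere -/

section Forms

variable {p q : ℕ} {E : HolLine}

theorem contDiff_coefN (s : Form p q E) : ContDiff ℝ ∞ (coefN s) := s.2.1

theorem contDiff_coefS (s : Form p q E) : ContDiff ℝ ∞ (coefS s) := s.2.2.1

theorem coefS_eq (s : Form p q E) {w : ℂ} (hw : w ≠ 0) :
    coefS s w = E.trans w * dzTrans w ^ p * conj (dzTrans w) ^ q * coefN s w⁻¹ :=
  s.2.2.2 w hw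

/-- The gluing relation gives the other coefficient for `w ≠ 0`, and continuity gives it at `w = 0`.
-/
theorem form_ext {s t : Form p q E} (h : coefN s = coefN t) : s = t := by
  refine Subtype.ext (Prod.ext h ?_)
  refine Continuous.ext_on (dense_compl_singleton (0 : ℂ)) (contDiff_coefS s).continuous
    (contDiff_coefS t).continuous fun w hw => ?_
  change coefS s w = coefS t w
  rw [coefS_eq s hw, coefS_eq t hw, h]

@[simp] theorem coefN_add (s t : Form p q E) (z : ℂ) :
    coefN (s + t) z = coefN s z + coefN t z := rfl

@[simp] theorem coefN_smul (c : ℂ) (s : Form p q E) (z : ℂ) :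
    coefN (c • s) z = c * coefN s z := rfl

@[simp] theorem coefN_zero (z : ℂ) : coefN (0 : Form p q E) z = 0 := rfl

@[simp] theorem coefN_delbar (s : Form p 0 E) (z : ℂ) :
    coefN (delbar p E s) z = (-1) ^ p * wirtBar (coefN s) z := rfl

@[simp] theorem coefN_wedge (φ : Form 1 0 E) (η : Form 0 1 E.dual) (z : ℂ) :
    coefN (wedge φ η) z = coefN φ z * coefN η z := rfl

theorem dzTrans_inv (z : ℂ) : dzTrans z⁻¹ = -z ^ 2 := by simp [dzTrans]

/-! ### Decay at the pole `N` and Stokes' theorem. -/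

theorem exists_norm_le_on_unit_ball {V : Type*} [NormedAddCommGroup V] {g : ℂ → V}
    (hg : Continuous g) : ∃ C, 0 ≤ C ∧ ∀ w, ‖w‖ ≤ 1 → ‖g w‖ ≤ C := by
  obtain ⟨C, hC⟩ := (isCompact_closedBall (0 : ℂ) 1).exists_bound_of_continuousOn hg.continuousOn
  exact ⟨C, (norm_nonneg _).trans (hC 0 (by simp)), fun w hw => hC w (by simpa using hw)⟩

theorem integrable_of_norm_le_inv_cube {V : Type*} [NormedAddCommGroup V]
    {f : ℂ → V} (hf : Continuous f) {C : ℝ}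
    (h : ∀ z, 1 ≤ ‖z‖ → ‖f z‖ ≤ C * (‖z‖ ^ 3)⁻¹) : Integrable f := by
  obtain ⟨M, hM0, hM⟩ := exists_norm_le_on_unit_ball hf
  have hC : 0 ≤ C := by
    have := (norm_nonneg _).trans (h 1 (by simp))
    simpa using this
  -- The factor `8 = 2³` comes from `1 + |z| ≤ 2` on the unit disc and `1 + |z| ≤ 2|z|` outside it.
  have hi : Integrable fun z : ℂ => (8 * (M + C)) * (1 + ‖z‖) ^ (-(3 : ℝ)) :=
    (integrable_one_add_norm (by rw [Complex.finrank_real_complex]; norm_num)).const_mul _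
  refine hi.mono' hf.aestronglyMeasurable (ae_of_all _ fun z => ?_)
  have e : (1 + ‖z‖) ^ (-(3 : ℝ)) = ((1 + ‖z‖) ^ 3)⁻¹ := by
    rw [Real.rpow_neg (by positivity)]
    norm_cast
  rw [e]
  have hz := norm_nonneg z
  rcases le_total ‖z‖ 1 with h1 | h1
  · refine (hM z h1).trans ?_
    rw [← div_eq_mul_inv, le_div_iff₀ (by positivity)]
    have : (1 + ‖z‖) ^ 3 ≤ 8 := by
      calc (1 + ‖z‖) ^ 3 ≤ (1 + 1) ^ 3 := by gcongr
        _ = 8 := by norm_num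
    nlinarith
  · refine (h z h1).trans ?_
    rw [← div_eq_mul_inv, ← div_eq_mul_inv, div_le_div_iff₀ (by positivity) (by positivity)]
    have : (1 + ‖z‖) ^ 3 ≤ 8 * ‖z‖ ^ 3 := by
      calc (1 + ‖z‖) ^ 3 ≤ (‖z‖ + ‖z‖) ^ 3 := by gcongr
        _ = 8 * ‖z‖ ^ 3 := by ring
    calc C * (1 + ‖z‖) ^ 3 ≤ C * (8 * ‖z‖ ^ 3) := by gcongr
      _ ≤ 8 * (M + C) * ‖z‖ ^ 3 := by
        have : 0 ≤ M * ‖z‖ ^ 3 := by positivity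
        linarith

/-- Boundedness of the coefficient near `w = 0` means decay `|z|⁻⁴` in the coordinate `z`. -/
theorem integrable_coefN (α : Form 1 1 trivialLine) : Integrable (coefN α) := by
  obtain ⟨C, hC0, hC⟩ := exists_norm_le_on_unit_ball (contDiff_coefS α).continuous
  refine integrable_of_norm_le_inv_cube (contDiff_coefN α).continuous (C := C) fun z hz => ?_
  have hz0 : z ≠ 0 := fun h => by simp [h] at hz; linarith
  have h1 := coefS_eq α (inv_ne_zero hz0)
  have h2 := hC z⁻¹ (by rw [norm_inv]; exact inv_le_one_of_one_le₀ hz)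
  rw [h1, dzTrans_inv, inv_inv] at h2
  simp only [trivialLine, one_mul, pow_one, norm_mul, norm_neg, norm_pow, RCLike.norm_conj] at h2
  rw [← div_eq_mul_inv, le_div_iff₀ (by positivity)]
  have h3 : ‖z‖ ^ 3 ≤ ‖z‖ ^ 2 * ‖z‖ ^ 2 := by
    rw [← pow_add]
    exact pow_le_pow_right₀ hz (by norm_num)
  calc ‖coefN α z‖ * ‖z‖ ^ 3 ≤ ‖coefN α z‖ * (‖z‖ ^ 2 * ‖z‖ ^ 2) := by gcongr
    _ = ‖z‖ ^ 2 * ‖z‖ ^ 2 * ‖coefN α z‖ := mul_comm _ _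
    _ ≤ C := h2

/-- By Fubini, each partial derivative is integrated first along its own coordinate lines, where the
fundamental theorem of calculus gives zero. -/
theorem integral_fderiv_eq_zero {F : ℂ → ℂ} (hF : Differentiable ℝ F)
    (h0 : Tendsto F (cocompact ℂ) (𝓝 0)) (hi : ∀ u, Integrable fun z => fderiv ℝ F z u) :
    ∫ z, fderiv ℝ F z 1 = 0 ∧ ∫ z, fderiv ℝ F z Complex.I = 0 := by
  have hmp := Complex.volume_preserving_equiv_real_prod.symm
  have hi' : ∀ u, Integrable
      (fun p : ℝ × ℝ => fderiv ℝ F (Complex.measurableEquivRealProd.symm p) u)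
      ((volume : Measure ℝ).prod volume) := fun u =>
    (hmp.integrable_comp_emb Complex.measurableEquivRealProd.symm.measurableEmbedding).2 (hi u)
  have htr : ∀ u, ∫ z, fderiv ℝ F z u =
      ∫ p : ℝ × ℝ, fderiv ℝ F (Complex.measurableEquivRealProd.symm p) u
        ∂((volume : Measure ℝ).prod volume) := fun u =>
    (hmp.integral_comp Complex.measurableEquivRealProd.symm.measurableEmbedding _).symm
  have hline : ∀ γ : ℝ → ℂ, ∀ u : ℂ, (∀ t, HasDerivAt γ u t) → (∀ t, |t| ≤ ‖γ t‖) →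
      Integrable (fun t => fderiv ℝ F (γ t) u) → ∫ t, fderiv ℝ F (γ t) u = 0 := by
    intro γ u hγ hn hint
    have hco : Tendsto γ (cocompact ℝ) (cocompact ℂ) := by
      rw [← Metric.cobounded_eq_cocompact (α := ℂ), ← comap_norm_atTop (E := ℂ), tendsto_comap_iff]
      exact tendsto_atTop_mono hn (tendsto_norm_cocompact_atTop (E := ℝ))
    have := integral_of_hasDerivAt_of_tendsto (f := fun t => F (γ t)) (m := 0) (n := 0)
      (fun t => (hF (γ t)).hasFDerivAt.comp_hasDerivAt t (hγ t)) hint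
      (h0.comp (hco.mono_left atBot_le_cocompact)) (h0.comp (hco.mono_left atTop_le_cocompact))
    simpa using this
  constructor
  · rw [htr, integral_prod_symm _ (hi' 1)]
    refine integral_eq_zero_of_ae ?_
    filter_upwards [(hi' 1).prod_left_ae] with y hy
    refine hline (fun x => Complex.measurableEquivRealProd.symm (x, y)) 1 (fun t => ?_)
      (fun t => Complex.abs_re_le_norm (Complex.measurableEquivRealProd.symm (t, y))) hy
    have : HasDerivAt (fun x : ℝ => (x : ℂ) + y * Complex.I) 1 t :=
      (Complex.ofRealCLM.hasDerivAt (x := t)).add_const _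
    refine this.congr_of_eventuallyEq (Eventually.of_forall fun x => ?_)
    apply Complex.ext <;> simp
  · rw [htr, integral_prod _ (hi' Complex.I)]
    refine integral_eq_zero_of_ae ?_
    filter_upwards [(hi' Complex.I).prod_right_ae] with x hx
    refine hline (fun y => Complex.measurableEquivRealProd.symm (x, y)) Complex.I (fun t => ?_)
      (fun t => Complex.abs_im_le_norm (Complex.measurableEquivRealProd.symm (x, t))) hx
    have : HasDerivAt (fun y : ℝ => (x : ℂ) + y * Complex.I) (1 * Complex.I) t :=
      ((Complex.ofRealCLM.hasDerivAt (x := t)).mul_const _).const_add _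
    rw [one_mul] at this
    refine this.congr_of_eventuallyEq (Eventually.of_forall fun y => ?_)
    apply Complex.ext <;> simp

/-- Stokes' theorem on the sphere for the `(1,0)`-form `α`. -/
theorem integral_wirtBar_coefN (α : Form 1 0 trivialLine) : ∫ z, wirtBar (coefN α) z = 0 := by
  set F := coefN α with hFdef
  set G := coefS α with hGdef
  have hF : ContDiff ℝ ∞ F := contDiff_coefN α
  have hG : ContDiff ℝ ∞ G := contDiff_coefS α
  have hFd : Differentiable ℝ F := hF.differentiable (by simp)
  have hGd : Differentiable ℝ G := hG.differentiable (by simp)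
  have hFG : ∀ z, z ≠ 0 → F z = -(z ^ 2)⁻¹ * G z⁻¹ := by
    intro z hz
    have := coefS_eq α (inv_ne_zero hz)
    rw [dzTrans_inv, inv_inv] at this
    rw [hGdef, this]
    simp only [trivialLine, pow_one, pow_zero, one_mul, mul_one, hFdef]
    field_simp
  obtain ⟨C, hC0, hC⟩ := exists_norm_le_on_unit_ball hG.continuous
  obtain ⟨D, hD0, hD⟩ := exists_norm_le_on_unit_ball (hG.continuous_fderiv (by simp))
  have hbF : ∀ z, 1 ≤ ‖z‖ → ‖F z‖ ≤ C * (‖z‖ ^ 2)⁻¹ := by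
    intro z hz
    have hz0 : z ≠ 0 := fun h => by simp [h] at hz; linarith
    rw [hFG z hz0, norm_mul, norm_neg, norm_inv, norm_pow, mul_comm]
    gcongr
    exact hC _ (by rw [norm_inv]; exact inv_le_one_of_one_le₀ hz)
  -- Differentiating `-z⁻² G(1/z)` gives a term in `dG` of order `|z|⁻⁴` and a term in `G` of order
  -- `2|z|⁻³`; this is where `D + 2C` comes from.
  have hbF' : ∀ z, 1 ≤ ‖z‖ → ‖fderiv ℝ F z‖ ≤ (D + 2 * C) * (‖z‖ ^ 3)⁻¹ := by
    intro z hz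
    have hz0 : z ≠ 0 := fun h => by simp [h] at hz; linarith
    have hzi : ‖z⁻¹‖ ≤ 1 := by rw [norm_inv]; exact inv_le_one_of_one_le₀ hz
    have hev : F =ᶠ[𝓝 z] fun v => -(v ^ 2)⁻¹ * G v⁻¹ := by
      filter_upwards [isOpen_compl_singleton.mem_nhds hz0] with v hv using hFG v hv
    have ha : HasDerivAt (fun v : ℂ => -(v ^ 2)⁻¹) (2 * (z ^ 3)⁻¹) z := by
      have := (((hasDerivAt_id z).pow 2).inv (pow_ne_zero 2 hz0)).neg
      refine this.congr_deriv ?_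
      simp
      field_simp
    have hφ : HasDerivAt (fun v : ℂ => v⁻¹) (-(z ^ 2)⁻¹) z := hasDerivAt_inv hz0
    have ha' := ha.hasFDerivAt.restrictScalars ℝ
    have hφ' := hφ.hasFDerivAt.restrictScalars ℝ
    have hprod := ha'.mul ((hGd z⁻¹).hasFDerivAt.comp z hφ')
    rw [hev.fderiv_eq]
    have hprod' : fderiv ℝ (fun v => -(v ^ 2)⁻¹ * G v⁻¹) z = _ := hprod.fderiv
    rw [hprod']
    refine ContinuousLinearMap.opNorm_le_bound _ (by positivity) fun u => ?_
    simp only [add_apply, smul_apply, ContinuousLinearMap.comp_apply,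
      ContinuousLinearMap.coe_restrictScalars', ContinuousLinearMap.toSpanSingleton_apply,
      Function.comp_apply, smul_eq_mul]
    have h1 : ‖fderiv ℝ G z⁻¹ (u * -(z ^ 2)⁻¹)‖ ≤ D * (‖u‖ * (‖z‖ ^ 2)⁻¹) := by
      refine ((fderiv ℝ G z⁻¹).le_opNorm _).trans ?_
      rw [norm_mul, norm_neg, norm_inv, norm_pow]
      gcongr
      exact hD _ hzi
    have hz2 : (‖z‖ ^ 2)⁻¹ * (‖z‖ ^ 2)⁻¹ ≤ (‖z‖ ^ 3)⁻¹ := by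
      rw [← mul_inv, ← pow_add]
      exact inv_anti₀ (by positivity) (pow_le_pow_right₀ hz (by norm_num))
    calc _ ≤ ‖-(z ^ 2)⁻¹ * fderiv ℝ G z⁻¹ (u * -(z ^ 2)⁻¹)‖ +
          ‖G z⁻¹ * (u * (2 * (z ^ 3)⁻¹))‖ := norm_add_le _ _
      _ ≤ (‖z‖ ^ 2)⁻¹ * (D * (‖u‖ * (‖z‖ ^ 2)⁻¹)) + C * (‖u‖ * (2 * (‖z‖ ^ 3)⁻¹)) := by
        rw [norm_mul, norm_mul, norm_mul, norm_mul, norm_neg, norm_inv, norm_inv, norm_pow,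
          norm_pow, Complex.norm_ofNat]
        gcongr
        exact hC _ hzi
      _ = D * ‖u‖ * ((‖z‖ ^ 2)⁻¹ * (‖z‖ ^ 2)⁻¹) + 2 * C * ‖u‖ * (‖z‖ ^ 3)⁻¹ := by ring
      _ ≤ D * ‖u‖ * (‖z‖ ^ 3)⁻¹ + 2 * C * ‖u‖ * (‖z‖ ^ 3)⁻¹ := by gcongr
      _ = _ := by ring
  have hlim : Tendsto F (cocompact ℂ) (𝓝 0) := by
    have h1 : Tendsto (fun z : ℂ => C * (‖z‖ ^ 2)⁻¹) (cocompact ℂ) (𝓝 (C * 0)) :=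
      (tendsto_inv_atTop_zero.comp ((tendsto_pow_atTop two_ne_zero).comp
        (tendsto_norm_cocompact_atTop (E := ℂ)))).const_mul C
    rw [mul_zero] at h1
    refine squeeze_zero_norm' ?_ h1
    filter_upwards [(tendsto_norm_cocompact_atTop (E := ℂ)).eventually_ge_atTop 1] with z hz
    exact hbF z hz
  have hi : ∀ u, Integrable fun z => fderiv ℝ F z u := fun u =>
    (integrable_of_norm_le_inv_cube (hF.continuous_fderiv (by simp)) hbF').apply_continuousLinearMap u
  obtain ⟨h1, h2⟩ := integral_fderiv_eq_zero hFd hlim hi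
  have hw : ∀ z, wirtBar F z =
      (1 / 2) * fderiv ℝ F z 1 + (Complex.I / 2) * fderiv ℝ F z Complex.I := fun z => by
    rw [wirtBar]
    ring
  simp only [hw]
  rw [integral_add ((hi 1).const_mul _) ((hi Complex.I).const_mul _), integral_const_mul,
    integral_const_mul, h1, h2]
  simp

end Forms

/-! ### The coupling -/

section Coupling

variable {E : HolLine}

/-- The factor 2 is `i dz ∧ dz̄ = 2 dx ∧ dy`. -/
theorem coupling_eq (φ : Form 1 0 E) (η : Form 0 1 E.dual) :
    coupling φ η = 2 * ∫ z, coefN φ z * coefN η z := by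
  rw [coupling, integralTwoForm, ← integral_const_mul]
  congr 1
  funext z
  rw [coefN_smul, coefN_wedge]
  linear_combination (-2 * (coefN φ z * coefN η z)) * Complex.I_sq

theorem integrable_coefN_mul (φ : Form 1 0 E) (η : Form 0 1 E.dual) :
    Integrable fun z => coefN φ z * coefN η z :=
  integrable_coefN (wedge φ η)

theorem wirtBar_eq_zero_of_mem_H10 (φ : H10 E) :
    (∀ z, wirtBar (coefN φ.1) z = 0) ∧ ∀ w, wirtBar (coefS φ.1) w = 0 := by
  have h := LinearMap.mem_ker.1 φ.2
  refine ⟨fun z => ?_, fun w => ?_⟩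
  · have : (-1) ^ 1 * wirtBar (coefN φ.1) z = 0 := congrArg (fun s => coefN s z) h
    simpa only [pow_one, neg_one_mul, neg_eq_zero] using this
  · have : (-1) ^ 1 * wirtBar (coefS φ.1) w = 0 := congrArg (fun s => coefS s w) h
    simpa only [pow_one, neg_one_mul, neg_eq_zero] using this

theorem differentiable_coefN (φ : H10 E) : Differentiable ℂ (coefN φ.1) := fun z =>
  differentiableAt_of_wirtBar_eq_zero ((contDiff_coefN φ.1).differentiable (by simp) z)
    ((wirtBar_eq_zero_of_mem_H10 φ).1 z)

theorem mem_H10_of_differentiable (φ : Form 1 0 E) (h : Differentiable ℂ (coefN φ)) :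
    φ ∈ H10 E := by
  refine LinearMap.mem_ker.2 (form_ext (funext fun z => ?_))
  simp [wirtBar_eq_zero_of_differentiableAt (h z)]

/-- Since `φ` is holomorphic, `φ ∂s/∂z̄ = ∂(φs)/∂z̄`, and `φs` is a global scalar `(1,0)`-form, to
which Stokes applies. -/
theorem coupling_delbar (φ : H10 E) (s : Form 0 0 E.dual) :
    coupling φ.1 (delbar 0 E.dual s) = 0 := by
  let α : Form 1 0 trivialLine :=
    ⟨(fun z => coefN φ.1 z * coefN s z, fun w => coefS φ.1 w * coefS s w),
      (contDiff_coefN _).mul (contDiff_coefN _), (contDiff_coefS _).mul (contDiff_coefS _),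
      fun w hw => by
        have := E.ne_zero w hw
        change coefS φ.1 w * coefS s w = _ * (coefN φ.1 w⁻¹ * coefN s w⁻¹)
        rw [coefS_eq φ.1 hw, coefS_eq s hw]
        simp only [HolLine.dual, trivialLine]
        field_simp⟩
  have h := integral_wirtBar_coefN α
  have e : ∀ z, wirtBar (coefN α) z = coefN φ.1 z * coefN (delbar 0 E.dual s) z := by
    intro z
    have := wirtBar_mul_of_differentiableAt (differentiable_coefN φ z)
      ((contDiff_coefN s).differentiable (by simp) z)
    rw [coefN_delbar, pow_zero, one_mul]
    exact this
  rw [coupling_eq]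
  simp only [← e, h, mul_zero]

/-- The coupling as a bilinear map on forms. -/
noncomputable def couplingForms (E : HolLine) : H10 E →ₗ[ℂ] Form 0 1 E.dual →ₗ[ℂ] ℂ :=
  LinearMap.mk₂ ℂ (fun φ η => coupling φ.1 η)
    (fun φ φ' η => by
      simp only [coupling_eq, Submodule.coe_add, coefN_add, add_mul]
      rw [integral_add (integrable_coefN_mul _ _) (integrable_coefN_mul _ _), mul_add])
    (fun c φ η => by
      simp only [coupling_eq, Submodule.coe_smul, coefN_smul, mul_assoc]
      rw [integral_const_mul, smul_eq_mul, mul_left_comm])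
    (fun φ η η' => by
      simp only [coupling_eq, coefN_add, mul_add]
      rw [integral_add (integrable_coefN_mul _ _) (integrable_coefN_mul _ _), mul_add])
    (fun c φ η => by
      simp only [coupling_eq, coefN_smul, mul_left_comm _ c]
      rw [integral_const_mul, smul_eq_mul, mul_left_comm])

/-- The coupling of `H^{1,0}(E)` and `H^{0,1}(E*)`. -/
noncomputable def couplingClasses (E : HolLine) : H10 E →ₗ[ℂ] H01 E.dual →ₗ[ℂ] ℂ :=
  ((LinearMap.range (delbar 0 E.dual)).liftQ (couplingForms E).flip (by
    rintro _ ⟨s, rfl⟩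
    exact LinearMap.mem_ker.2 (LinearMap.ext fun φ => coupling_delbar φ s))).flip

theorem couplingClasses_cls (φ : H10 E) (η : Form 0 1 E.dual) :
    couplingClasses E φ (cls η) = coupling φ.1 η := rfl

end Coupling

/-! ### Exact forms -/

/-- Every class has a representative supported away from the pole `N`. -/
theorem exists_hasCompactSupport_sub_delbar {E : HolLine} (η : Form 0 1 E) :
    ∃ s : Form 0 0 E, HasCompactSupport (coefN (η - delbar 0 E s)) := by
  let χ : ContDiffBump (0 : ℂ) := ⟨1, 2, one_pos, one_lt_two⟩
  have hχ : ContDiff ℝ ∞ fun w => (χ w : ℂ) := Complex.ofRealCLM.contDiff.comp χ.contDiff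
  have hχ1 : ∀ w, ‖w‖ ≤ 1 → χ w = 1 := fun w hw =>
    χ.one_of_mem_closedBall (by simpa [χ] using hw)
  have hχ0 : ∀ w, 2 ≤ ‖w‖ → χ w = 0 := fun w hw => χ.zero_of_le_dist (by simpa [χ] using hw)
  have hχc : HasCompactSupport fun w => (χ w : ℂ) :=
    χ.hasCompactSupport.comp_left Complex.ofReal_zero
  set b : ℂ → ℂ := fun w => χ w * coefS η w with hb
  have hbs : ContDiff ℝ ∞ b := hχ.mul (contDiff_coefS η)
  have hbc : HasCompactSupport b := hχc.mul_right
  -- The inner cutoff makes the Cauchy transform available, and on `|w| < 1` both cutoffs equal 1,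
  -- so `t` solves the `∂̄`-equation there. The outer cutoff makes `t` extend by zero to the rest of
  -- the sphere.
  set t : ℂ → ℂ := fun w => χ w * cauchyTransform b w with ht
  have hts : ContDiff ℝ ∞ t := hχ.mul (contDiff_cauchyTransform hbs hbc)
  have htd : ∀ w, ‖w‖ < 1 → wirtBar t w = coefS η w := by
    intro w hw
    have hev : t =ᶠ[𝓝 w] cauchyTransform b := by
      filter_upwards [Metric.isOpen_ball.mem_nhds (mem_ball_zero_iff.2 hw)] with v hv
      simp [ht, hχ1 v (mem_ball_zero_iff.1 hv).le]
    rw [wirtBar_congr hev, wirtBar_cauchyTransform hbs hbc]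
    simp [hb, hχ1 w hw.le]
  -- This is `t` in the other frame. It vanishes for `0 < |z| < 1/2`, so the value 0 at the origin
  -- keeps it smooth.
  set r : ℂ → ℂ := fun z => if z = 0 then 0 else (E.trans z⁻¹)⁻¹ * t z⁻¹ with hr
  have hrs : ContDiff ℝ ∞ r := by
    rw [contDiff_iff_contDiffAt]
    intro z
    by_cases hz : z = 0
    · have hev : r =ᶠ[𝓝 z] fun _ => 0 := by
        rw [hz]
        filter_upwards [Metric.ball_mem_nhds (0 : ℂ) (by norm_num : (0 : ℝ) < 1 / 2)] with v hv
        by_cases hv0 : v = 0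
        · simp [hr, hv0]
        · have : 2 ≤ ‖v⁻¹‖ := by
            rw [norm_inv, le_inv_comm₀ two_pos (norm_pos_iff.2 hv0)]
            have := mem_ball_zero_iff.1 hv
            norm_num at this ⊢
            exact this.le
          simp [hr, hv0, ht, hχ0 _ this]
      exact contDiffAt_const.congr_of_eventuallyEq hev
    · have hev : r =ᶠ[𝓝 z] fun v => (E.trans v⁻¹)⁻¹ * t v⁻¹ := by
        filter_upwards [isOpen_compl_singleton.mem_nhds hz] with v hv
        exact if_neg hv
      refine ContDiffAt.congr_of_eventuallyEq ?_ hev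
      have hinv : ContDiffAt ℝ ∞ (fun v : ℂ => v⁻¹) z := contDiffAt_inv ℝ hz
      have htr : ContDiffAt ℝ ∞ E.trans z⁻¹ :=
        ((E.holo.contDiffOn isOpen_compl_singleton).contDiffAt
          (isOpen_compl_singleton.mem_nhds (inv_ne_zero hz))).restrict_scalars ℝ
      have h1 : ContDiffAt ℝ ∞ (fun v => E.trans v⁻¹) z := ContDiffAt.comp z htr hinv
      exact (h1.inv (E.ne_zero _ (inv_ne_zero hz))).mul (ContDiffAt.comp z hts.contDiffAt hinv)
  let s : Form 0 0 E := ⟨(r, t), hrs, hts, fun w hw => by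
    have := E.ne_zero w hw
    simp only [hr, inv_eq_zero, hw, if_false, inv_inv, pow_zero, mul_one]
    field_simp⟩
  refine ⟨s, HasCompactSupport.intro (isCompact_closedBall 0 1) fun z hz => ?_⟩
  have hz1 : 1 < ‖z‖ := by simpa using hz
  have hz0 : z ≠ 0 := fun h => by simp [h] at hz1; linarith
  have h1 := coefS_eq (η - delbar 0 E s) (inv_ne_zero hz0)
  have h2 : coefS (η - delbar 0 E s) z⁻¹ = 0 := by
    change coefS η z⁻¹ - (-1) ^ 0 * wirtBar t z⁻¹ = 0
    rw [htd _ (by rw [norm_inv]; exact inv_lt_one_of_one_lt₀ hz1)]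
    ring
  rw [h2, inv_inv, dzTrans_inv, eq_comm] at h1
  have hE := E.ne_zero _ (inv_ne_zero hz0)
  simpa [hE, hz0] using h1

/-- The Cauchy transform `u` solves the equation in the coordinate `z`. In the frame at `N` it reads
`w^{-k} u(1/w)`, holomorphic on a punctured disc; the `k - 1` vanishing moments make this `o(1/w)`,
so the singularity is removable. -/
theorem exists_delbar_eq_of_hasCompactSupport {k : ℕ} (hk : 1 ≤ k)
    (η : Form 0 1 (lineOfDegree k).dual) (hc : HasCompactSupport (coefN η))
    (hm : ∀ j < k - 1, ∫ z, z ^ j * coefN η z = 0) :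
    ∃ s, delbar 0 (lineOfDegree k).dual s = η := by
  set a := coefN η with ha
  have has : ContDiff ℝ ∞ a := contDiff_coefN η
  set u := cauchyTransform a with hu
  have hus : ContDiff ℝ ∞ u := contDiff_cauchyTransform has hc
  have hud : ∀ z, wirtBar u z = a z := wirtBar_cauchyTransform has hc
  have hdecay := tendsto_pow_mul_cauchyTransform has.continuous hc (k - 1) hm
  rw [← hu] at hdecay
  clear_value u
  obtain ⟨R, hR0, hR⟩ : ∃ R : ℝ, 0 < R ∧ ∀ z, R ≤ ‖z‖ → a z = 0 := by
    obtain ⟨R, hR0, hR⟩ := hc.isCompact.isBounded.subset_ball_lt 0 0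
    refine ⟨R, hR0, fun z hz => image_eq_zero_of_notMem_tsupport fun h => ?_⟩
    have := hR h
    simp at this
    linarith
  set f : ℂ → ℂ := fun w => (w ^ k)⁻¹ * u w⁻¹ with hf
  have hfd : DifferentiableOn ℂ f (Metric.ball 0 R⁻¹ \ {0}) := by
    rintro w ⟨hw, hw0⟩
    have hw0 : w ≠ 0 := hw0
    have hwR : R ≤ ‖w⁻¹‖ := by
      rw [norm_inv, le_inv_comm₀ hR0 (norm_pos_iff.2 hw0)]
      exact (mem_ball_zero_iff.1 hw).le
    have h1 : DifferentiableAt ℂ u w⁻¹ :=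
      differentiableAt_of_wirtBar_eq_zero (hus.differentiable (by simp) _)
        (by rw [hud, hR _ hwR])
    have h2 : DifferentiableAt ℂ (fun v => u v⁻¹) w :=
      DifferentiableAt.comp w h1 (differentiableAt_inv hw0)
    exact (((differentiableAt_id.pow k).inv (pow_ne_zero k hw0)).mul h2).differentiableWithinAt
  -- A default value: `0⁻¹ = 0`. The removable singularity theorem is phrased with `f w - f 0`, and
  -- `S` later replaces this value by the limit.
  have hf0 : f 0 = 0 := by
    have : k ≠ 0 := by omega
    simp [hf, this]
  have ho : (fun w => f w - f 0) =o[𝓝[≠] 0] fun w => (w - 0)⁻¹ := by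
    rw [Asymptotics.isLittleO_iff_tendsto']
    · have h1 := hdecay
      rw [← Metric.cobounded_eq_cocompact] at h1
      refine (h1.comp tendsto_inv₀_nhdsNE_zero).congr' ?_
      filter_upwards [self_mem_nhdsWithin] with w hw
      have hw : w ≠ 0 := hw
      obtain ⟨n, rfl⟩ : ∃ n, k = n + 1 := ⟨k - 1, by omega⟩
      rw [hf0]
      simp only [Function.comp_apply, sub_zero, hf, Nat.add_sub_cancel]
      rw [inv_pow, pow_succ]
      field_simp
    · filter_upwards [self_mem_nhdsWithin] with w hw h
      have hw : w ≠ 0 := hw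
      simp [hw] at h
  have hball : Metric.ball (0 : ℂ) R⁻¹ ∈ 𝓝 0 := Metric.ball_mem_nhds _ (inv_pos.2 hR0)
  have hrem := Complex.differentiableOn_update_limUnder_of_isLittleO hball hfd ho
  set S := Function.update f 0 (limUnder (𝓝[≠] 0) f) with hS
  have hSs : ContDiff ℝ ∞ S := by
    rw [contDiff_iff_contDiffAt]
    intro w
    by_cases hw : w = 0
    · rw [hw]
      exact ((hrem.contDiffOn Metric.isOpen_ball).contDiffAt hball).restrict_scalars ℝ
    · have hev : S =ᶠ[𝓝 w] f := by
        filter_upwards [isOpen_compl_singleton.mem_nhds hw] with v hv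
        exact Function.update_of_ne hv _ _
      refine ContDiffAt.congr_of_eventuallyEq ?_ hev
      have h1 : ContDiffAt ℝ ∞ (fun v => u v⁻¹) w :=
        ContDiffAt.comp w hus.contDiffAt (contDiffAt_inv ℝ hw)
      exact ((contDiffAt_id.pow k).inv (pow_ne_zero k hw)).mul h1
  refine ⟨⟨(u, S), hus, hSs, fun w hw => ?_⟩, form_ext (funext fun z => ?_)⟩
  · change S w = _
    rw [hS, Function.update_of_ne hw]
    simp [hf, HolLine.dual, lineOfDegree]
  · rw [coefN_delbar, pow_zero, one_mul]
    exact hud z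

theorem cls_surjective {E : HolLine} : Function.Surjective (cls : Form 0 1 E → H01 E) :=
  Submodule.mkQ_surjective _

theorem cls_delbar {E : HolLine} (s : Form 0 0 E) : cls (delbar 0 E s) = 0 :=
  (Submodule.Quotient.mk_eq_zero _).2 ⟨s, rfl⟩

/-- The form `z^j ζ_L dz`. -/
noncomputable def monomialForm (k j : ℕ) (hj : j + 2 ≤ k) : H10 (lineOfDegree k) :=
  -- The gluing factor gives `w^k · (-w⁻²) · w^{-j}`, which is regular at `w = 0` because `j + 2 ≤
  -- k`.
  ⟨⟨(fun z => z ^ j, fun w => -w ^ (k - 2 - j)), contDiff_id.pow j, (contDiff_id.pow _).neg,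
    fun w hw => by
      obtain ⟨n, rfl⟩ := Nat.exists_eq_add_of_le hj
      have e : j + 2 + n - 2 - j = n := by omega
      simp only [lineOfDegree, dzTrans, e]
      rw [pow_add, pow_add, inv_pow]
      field_simp⟩,
    mem_H10_of_differentiable _ (differentiable_id.pow j)⟩

@[simp] theorem coefN_monomialForm (k j : ℕ) (hj : j + 2 ≤ k) (z : ℂ) :
    coefN (monomialForm k j hj).1 z = z ^ j := rfl

/-- For a representative with compact support in `z`, the couplings with the monomial forms are, up
to the factor 2, the moments that obstruct exactness. -/
theorem eq_zero_of_couplingClasses_eq_zero {k : ℕ} (hk : 1 ≤ k)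
    (c : H01 (lineOfDegree k).dual)
    (h : ∀ φ, couplingClasses (lineOfDegree k) φ c = 0) : c = 0 := by
  obtain ⟨η, rfl⟩ := cls_surjective c
  obtain ⟨s, hs⟩ := exists_hasCompactSupport_sub_delbar η
  set η' := η - delbar 0 _ s with hη'
  have hcls : cls η = cls η' := by
    have e : η = η' + delbar 0 _ s := by rw [hη', sub_add_cancel]
    rw [e]
    change cls η' + cls (delbar 0 _ s) = _
    rw [cls_delbar, add_zero]
  rw [hcls] at h ⊢
  obtain ⟨t, ht⟩ := exists_delbar_eq_of_hasCompactSupport hk η' hs fun j hj => by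
    have := h (monomialForm k j (by omega))
    rw [couplingClasses_cls, coupling_eq] at this
    simpa using this
  rw [← ht, cls_delbar]

/-! ### Antiholomorphic forms -/

/-- For the dual metric `h⁻¹` one has `D' = h ∘ ∂ ∘ h⁻¹`, so on `ḡh` only `h ∂ḡ` survives, and `∂ḡ`
is the conjugate of `∂̄g`. -/
theorem chernCoef_conj_mul {g : ℂ → ℂ} {h : ℂ → ℝ} (hg : Differentiable ℝ g)
    (hh : Differentiable ℝ h) (hpos : ∀ z, 0 < h z) (z : ℂ) :
    chernCoef (fun v => (h v)⁻¹) (fun v => conj (g v) * h v) z = h z * conj (wirtBar g z) := by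
  have hgc : HasFDerivAt (fun v => conj (g v)) _ z :=
    (Complex.conjCLE : ℂ →L[ℝ] ℂ).hasFDerivAt.comp z (hg z).hasFDerivAt
  have hhc : HasFDerivAt (fun v => (h v : ℂ)) _ z :=
    Complex.ofRealCLM.hasFDerivAt.comp z (hh z).hasFDerivAt
  have hlog : HasFDerivAt (fun v => (Real.log (h v) : ℂ)) _ z :=
    Complex.ofRealCLM.hasFDerivAt.comp z ((hh z).hasFDerivAt.log (hpos z).ne')
  have hne : (h z : ℂ) ≠ 0 := by exact_mod_cast (hpos z).ne'
  have hmul : fderiv ℝ (fun v => conj (g v) * (h v : ℂ)) z = _ := (hgc.mul hhc).fderiv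
  unfold chernCoef wirt wirtBar
  simp only [Real.log_inv, Complex.ofReal_neg]
  rw [hmul, fderiv_fun_neg, hlog.fderiv]
  have h2 : conj (2 : ℂ) = 2 := map_ofNat _ 2
  simp only [h2, map_div₀, map_add, map_mul, Complex.conj_I, add_apply, smul_apply, neg_apply,
    ContinuousLinearMap.comp_apply, ContinuousLinearEquiv.coe_coe, Complex.conjCLE_apply,
    Complex.ofRealCLM_apply, smul_eq_mul, Complex.ofReal_mul,
    Complex.ofReal_inv]
  field_simp
  ring

/-- With `g` the coefficient of `η^{*H}`, that of `η` is `ḡh`. By `chernCoef_conj_mul`, `D'η` then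
vanishes exactly where `∂̄g` does. -/
theorem isAntiholomorphic_iff {E : HolLine} (H : HermMetric E) (η : Form 0 1 E.dual) :
    IsAntiholomorphic H.dual η ↔ hDual H η ∈ H10 E := by
  have key : ∀ (h : ℂ → ℝ) (a : ℂ → ℂ), ContDiff ℝ ∞ h → ContDiff ℝ ∞ a → (∀ z, 0 < h z) →
      ∀ z, chernCoef (fun v => (h v)⁻¹) a z =
        h z * conj (wirtBar (fun v => conj (a v) * ((h v)⁻¹ : ℝ)) z) := by
    intro h a hh ha hpos z
    have hg : ContDiff ℝ ∞ fun v => conj (a v) * (((h v)⁻¹ : ℝ) : ℂ) :=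
      (Complex.conjCLE.contDiff.comp ha).mul
        (Complex.ofRealCLM.contDiff.comp (hh.inv fun z => (hpos z).ne'))
    rw [← chernCoef_conj_mul (hg.differentiable (by simp)) (hh.differentiable (by simp)) hpos]
    congr 1
    funext v
    have hne : (h v : ℂ) ≠ 0 := by exact_mod_cast (hpos v).ne'
    simp [hne]
  have kN := key H.hN (coefN η) H.smoothN (contDiff_coefN η) H.posN
  have kS := key H.hS (coefS η) H.smoothS (contDiff_coefS η) H.posS
  constructor
  · intro h
    refine LinearMap.mem_ker.2 (form_ext (funext fun z => ?_))
    have h1 := (kN z).symm.trans (h.1 z)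
    have hne : (H.hN z : ℂ) ≠ 0 := by exact_mod_cast (H.posN z).ne'
    have h2 := (map_eq_zero _).1 ((mul_eq_zero.1 h1).resolve_left hne)
    change (-1) ^ 1 * wirtBar _ z = 0
    rw [mul_eq_zero]
    exact Or.inr h2
  · intro h
    obtain ⟨hN, hS⟩ := wirtBar_eq_zero_of_mem_H10 ⟨hDual H η, h⟩
    refine ⟨fun z => (kN z).trans ?_, fun w => (kS w).trans ?_⟩
    · exact mul_eq_zero_of_right _ ((map_eq_zero _).2 (hN z))
    · exact mul_eq_zero_of_right _ ((map_eq_zero _).2 (hS w))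

/-- The form `η` with `η^{*H} = φ`. -/
noncomputable def hPredual {E : HolLine} (H : HermMetric E) (φ : Form 1 0 E) :
    Form 0 1 E.dual :=
  ⟨(fun z => conj (coefN φ z) * (H.hN z : ℂ), fun w => conj (coefS φ w) * (H.hS w : ℂ)),
    (Complex.conjCLE.contDiff.comp (contDiff_coefN φ)).mul
      (Complex.ofRealCLM.contDiff.comp H.smoothN),
    (Complex.conjCLE.contDiff.comp (contDiff_coefS φ)).mul
      (Complex.ofRealCLM.contDiff.comp H.smoothS), fun w hw => by
    have h0 := E.ne_zero w hw
    have hc : (H.hN w⁻¹ : ℂ) = E.trans w * conj (E.trans w) * H.hS w := by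
      rw [H.compat w hw, Complex.mul_conj, Complex.normSq_eq_norm_sq]
      push_cast
      ring
    simp only [coefS_eq φ hw, HolLine.dual, hc, map_mul, pow_zero, pow_one, mul_one]
    field_simp⟩

@[simp] theorem coefN_hPredual {E : HolLine} (H : HermMetric E) (φ : Form 1 0 E) (z : ℂ) :
    coefN (hPredual H φ) z = conj (coefN φ z) * H.hN z := rfl

@[simp] theorem coefN_hDual {E : HolLine} (H : HermMetric E) (η : Form 0 1 E.dual) (z : ℂ) :
    coefN (hDual H η) z = conj (coefN η z) * ((H.hN z)⁻¹ : ℝ) := rfl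

theorem hDual_hPredual {E : HolLine} (H : HermMetric E) (φ : Form 1 0 E) :
    hDual H (hPredual H φ) = φ := by
  refine form_ext (funext fun z => ?_)
  have hne : (H.hN z : ℂ) ≠ 0 := by exact_mod_cast (H.posN z).ne'
  simp [hne]

theorem hPredual_hDual {E : HolLine} (H : HermMetric E) (η : Form 0 1 E.dual) :
    hPredual H (hDual H η) = η := by
  refine form_ext (funext fun z => ?_)
  have hne : (H.hN z : ℂ) ≠ 0 := by exact_mod_cast (H.posN z).ne'
  simp [hne]

/-- The class of the form `η` with `η^{*H} = φ`, for holomorphic `φ`. -/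
noncomputable def antiClass {E : HolLine} (H : HermMetric E) :
    H10 E →ₛₗ[starRingEnd ℂ] H01 E.dual where
  toFun φ := cls (hPredual H φ.1)
  map_add' φ ψ := by
    have : hPredual H (φ + ψ).1 = hPredual H φ.1 + hPredual H ψ.1 :=
      form_ext (funext fun z => by simp [add_mul])
    rw [this]
    rfl
  map_smul' c φ := by
    have : hPredual H (c • φ).1 = conj c • hPredual H φ.1 :=
      form_ext (funext fun z => by simp [mul_assoc])
    rw [this]
    rfl

/-- The coupling equals `2∫|φ|²h`, with a continuous nonnegative integrand, so it vanishes only for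
`φ = 0`. -/
theorem eq_zero_of_couplingClasses_antiClass {E : HolLine} (H : HermMetric E) (φ : H10 E)
    (h : couplingClasses E φ (antiClass H φ) = 0) : φ = 0 := by
  have hi := integrable_coefN_mul φ.1 (hPredual H φ.1)
  have e : ∀ z, coefN φ.1 z * coefN (hPredual H φ.1) z = ((‖coefN φ.1 z‖ ^ 2 * H.hN z : ℝ) : ℂ) := by
    intro z
    rw [coefN_hPredual, ← mul_assoc, Complex.mul_conj, Complex.normSq_eq_norm_sq]
    push_cast
    ring
  have h' : coupling φ.1 (hPredual H φ.1) = 0 := h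
  rw [coupling_eq] at h'
  simp only [e] at h' hi
  rw [integral_complex_ofReal, mul_eq_zero, or_iff_right two_ne_zero, Complex.ofReal_eq_zero,
    integral_eq_zero_iff_of_nonneg
      (fun z => mul_nonneg (by positivity) (H.posN z).le) hi.re] at h'
  have hcont : Continuous fun z => ‖coefN φ.1 z‖ ^ 2 * H.hN z :=
    ((contDiff_coefN φ.1).continuous.norm.pow 2).mul H.smoothN.continuous
  have h2 := (Continuous.ae_eq_iff_eq volume hcont continuous_const).1 h'
  refine Subtype.ext (form_ext (funext fun z => ?_))
  have h3 : ‖coefN φ.1 z‖ ^ 2 * H.hN z = 0 := congrFun h2 z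
  have h4 := (mul_eq_zero.1 h3).resolve_right (H.posN z).ne'
  exact norm_eq_zero.1 (pow_eq_zero_iff two_ne_zero |>.1 h4)

/-! ### The basis of holomorphic forms -/

/-- An entire function of polynomial growth is a polynomial. -/
theorem exists_eq_sum_of_norm_le_pow (n : ℕ) : ∀ f : ℂ → ℂ, Differentiable ℂ f →
    (∃ C, ∀ z, 1 ≤ ‖z‖ → ‖f z‖ ≤ C * ‖z‖ ^ n) →
    ∃ c : ℕ → ℂ, ∀ z, f z = ∑ j ∈ Finset.range (n + 1), c j * z ^ j := by
  induction n with
  | zero =>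
    rintro f hf ⟨C, hC⟩
    obtain ⟨D, hD0, hD⟩ := exists_norm_le_on_unit_ball hf.continuous
    have hb : Bornology.IsBounded (Set.range f) := by
      refine isBounded_iff_forall_norm_le.2 ⟨max C D, ?_⟩
      rintro _ ⟨z, rfl⟩
      rcases le_total ‖z‖ 1 with h | h
      · exact (hD z h).trans (le_max_right _ _)
      · exact (by simpa using hC z h : ‖f z‖ ≤ C).trans (le_max_left _ _)
    exact ⟨fun _ => f 0, fun z => by simpa using hf.apply_eq_apply_of_bounded hb z 0⟩
  | succ n ih =>
    rintro f hf ⟨C, hC⟩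
    -- Passing to `(f(z) - f(0))/z`, with the singularity filled in by `dslope`, lowers the growth
    -- exponent by one.
    have hg : Differentiable ℂ (dslope f 0) := by
      rw [← differentiableOn_univ] at hf ⊢
      exact (Complex.differentiableOn_dslope univ_mem).2 hf
    have hfg : ∀ z, f z = z * dslope f 0 z + f 0 := fun z => by
      have := sub_smul_dslope f 0 z
      rw [sub_zero, smul_eq_mul] at this
      rw [this, sub_add_cancel]
    have hbound : ∀ z, 1 ≤ ‖z‖ → ‖dslope f 0 z‖ ≤ (C + ‖f 0‖) * ‖z‖ ^ n := by
      intro z hz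
      have hz0 : 0 < ‖z‖ := by linarith
      have h1 : z * dslope f 0 z = f z - f 0 := by rw [hfg z, add_sub_cancel_right]
      have h2 : ‖z‖ * ‖dslope f 0 z‖ ≤ C * ‖z‖ ^ (n + 1) + ‖f 0‖ * ‖z‖ ^ (n + 1) := by
        rw [← norm_mul, h1]
        refine (norm_sub_le _ _).trans (add_le_add (hC z hz) ?_)
        exact le_mul_of_one_le_right (norm_nonneg _) (one_le_pow₀ hz)
      refine le_of_mul_le_mul_left (h2.trans (le_of_eq ?_)) hz0
      ring
    obtain ⟨c, hc⟩ := ih (dslope f 0) hg ⟨_, hbound⟩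
    refine ⟨fun j => if j = 0 then f 0 else c (j - 1), fun z => ?_⟩
    rw [Finset.sum_range_succ', hfg, hc, Finset.mul_sum]
    simp only [if_true, pow_zero, mul_one, Nat.succ_ne_zero, if_false, Nat.add_sub_cancel]
    congr 1
    exact Finset.sum_congr rfl fun j _ => by ring

/-- The gluing relation reads `φ_N(z) = -z^{k-2} φ_S(1/z)` with `φ_S` bounded near 0, so `φ_N` is
entire with growth at most `|z|^{k-2}`. -/
theorem exists_coefN_eq_sum {k : ℕ} (hk : 2 ≤ k) (φ : H10 (lineOfDegree k)) :
    ∃ c : ℕ → ℂ, ∀ z, coefN φ.1 z = ∑ j ∈ Finset.range (k - 1), c j * z ^ j := by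
  obtain ⟨n, rfl⟩ := Nat.exists_eq_add_of_le' hk
  obtain ⟨C, hC0, hC⟩ := exists_norm_le_on_unit_ball (contDiff_coefS φ.1).continuous
  refine exists_eq_sum_of_norm_le_pow n _ (differentiable_coefN φ) ⟨C, fun z hz => ?_⟩
  have hz0 : z ≠ 0 := fun h => by simp [h] at hz; linarith
  have h1 := coefS_eq φ.1 (inv_ne_zero hz0)
  have h2 := hC z⁻¹ (by rw [norm_inv]; exact inv_le_one_of_one_le₀ hz)
  have h3 : coefN φ.1 z = -(z ^ n * coefS φ.1 z⁻¹) := by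
    rw [h1, dzTrans_inv, inv_inv]
    simp only [lineOfDegree, pow_one, pow_zero, mul_one, inv_pow, pow_add z n 2]
    field_simp
  rw [h3, norm_neg, norm_mul, norm_pow, mul_comm]
  gcongr

theorem eq_zero_of_sum_pow_eq_zero {n : ℕ} (c : Fin n → ℂ)
    (h : ∀ z : ℂ, ∑ j, c j * z ^ (j : ℕ) = 0) : c = 0 := by
  have hp : (∑ j : Fin n, Polynomial.C (c j) * Polynomial.X ^ (j : ℕ)) = 0 :=
    Polynomial.funext fun z => by simpa [Polynomial.eval_finsetSum] using h z
  funext i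
  have := congrArg (fun p => Polynomial.coeff p (i : ℕ)) hp
  simpa [Polynomial.finsetSum_coeff, Polynomial.coeff_C_mul, Polynomial.coeff_X_pow,
    Fin.val_inj] using this

/-! ### Perfect pairings from antilinear maps -/

section Pairing

variable {V W : Type*} [AddCommGroup V] [Module ℂ V] [AddCommGroup W] [Module ℂ W] {n : ℕ}

/-- The dimension count that stands in for Hodge theory. `hP` embeds `W` in `ℂⁿ` and `hT` embeds `V`
in `W`; the composite is an injection between spaces of equal finite dimension, hence onto, which
forces both factors to be onto. Finite dimensionality of `W` is a consequence. -/
theorem bijective_of_pairing (β : Module.Basis (Fin n) ℂ V) (P : V →ₗ[ℂ] W →ₗ[ℂ] ℂ)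
    (hP : ∀ w, (∀ v, P v w = 0) → w = 0) (T : V →ₛₗ[starRingEnd ℂ] W)
    (hT : ∀ v, P v (T v) = 0 → v = 0) :
    Function.Bijective T ∧ Function.Bijective (LinearMap.pi fun i => P (β i)) := by
  set ψ : W →ₗ[ℂ] Fin n → ℂ := LinearMap.pi fun i => P (β i) with hψ
  have hψinj : Function.Injective ψ := by
    rw [← LinearMap.ker_eq_bot, LinearMap.ker_eq_bot']
    intro w hw
    refine hP w fun v => ?_
    have h0 : P.flip w = 0 := β.ext fun i => congrFun hw i
    exact LinearMap.congr_fun h0 v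
  have hTinj : Function.Injective T := by
    rw [injective_iff_map_eq_zero]
    intro v hv
    exact hT v (by rw [hv, map_zero])
  -- `T` is conjugate-linear, so dimensions are compared over `ℝ`.
  let Φ : V →ₗ[ℝ] Fin n → ℂ :=
    { toFun := fun v => ψ (T v)
      map_add' := fun v w => by simp
      map_smul' := fun r v => by
        have h1 : r • v = (r : ℂ) • v := rfl
        rw [h1, map_smulₛₗ, map_smul, Complex.conj_ofReal]
        rfl }
  have : FiniteDimensional ℂ V := β.finiteDimensional_of_finite
  have hdim : Module.finrank ℝ V = Module.finrank ℝ (Fin n → ℂ) := by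
    rw [finrank_real_of_complex, finrank_real_of_complex, Module.finrank_eq_card_basis β]
    simp
  have hΦinj : Function.Injective Φ := hψinj.comp hTinj
  have hΦ : Function.Surjective Φ :=
    (LinearMap.injective_iff_surjective_of_finrank_eq_finrank hdim).1 hΦinj
  refine ⟨⟨hTinj, fun w => ?_⟩, hψinj, fun x => ?_⟩
  · obtain ⟨v, hv⟩ := hΦ (ψ w)
    exact ⟨v, hψinj hv⟩
  · obtain ⟨v, hv⟩ := hΦ x
    exact ⟨T v, hv⟩

theorem exists_dual_basis (β : Module.Basis (Fin n) ℂ V) (P : V →ₗ[ℂ] W →ₗ[ℂ] ℂ)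
    (h : Function.Bijective (LinearMap.pi fun i => P (β i))) :
    ∃ βd : Module.Basis (Fin n) ℂ W, (∀ i j, P (β i) (βd j) = if i = j then 1 else 0) ∧
      ∀ w j, βd.repr w j = P (β j) w := by
  refine ⟨.ofEquivFun (LinearEquiv.ofBijective _ h), fun i j => ?_, fun w j => rfl⟩
  have := congrFun ((LinearEquiv.ofBijective _ h).apply_symm_apply (Pi.single j 1)) i
  rw [Module.Basis.coe_ofEquivFun]
  refine Eq.trans this ?_
  simp [Pi.single_apply]

end Pairing

/-- The metric `|ζ_L|² = (1 + |z|²)^{-k}` on the bundle of degree `k`. -/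
noncomputable def fubiniStudy (k : ℕ) : HermMetric (lineOfDegree k) where
  hN := fun z => ((1 + ‖z‖ ^ 2) ^ k)⁻¹
  hS := fun w => ((1 + ‖w‖ ^ 2) ^ k)⁻¹
  smoothN := ((contDiff_const.add (contDiff_norm_sq ℝ)).pow k).inv fun z => by positivity
  smoothS := ((contDiff_const.add (contDiff_norm_sq ℝ)).pow k).inv fun z => by positivity
  posN := fun z => by positivity
  posS := fun w => by positivity
  compat := fun w hw => by
    have hw' : ‖w‖ ≠ 0 := norm_ne_zero_iff.2 hw
    have e : 1 + ‖w⁻¹‖ ^ 2 = (1 + ‖w‖ ^ 2) * (‖w‖ ^ 2)⁻¹ := by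
      rw [norm_inv]
      field_simp
      ring
    simp only [lineOfDegree, e, mul_pow, norm_pow, mul_inv, inv_pow, inv_inv]
    ring

/-! ### The monomial basis of `H^{1,0}(L)`. -/

theorem exists_basis_of_eval_eq_pow {V : Type*} [AddCommGroup V] [Module ℂ V] {n : ℕ}
    (ev : V →ₗ[ℂ] ℂ → ℂ) (hinj : Function.Injective ev) (b : Fin n → V)
    (hb : ∀ j z, ev (b j) z = z ^ (j : ℕ))
    (hs : ∀ v, ∃ c : ℕ → ℂ, ∀ z, ev v z = ∑ j ∈ Finset.range n, c j * z ^ j) :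
    ∃ β : Module.Basis (Fin n) ℂ V, ⇑β = b := by
  have hsum : ∀ (c : Fin n → ℂ) (z : ℂ), ev (∑ j, c j • b j) z = ∑ j, c j * z ^ (j : ℕ) := by
    intro c z
    simp [map_sum, Finset.sum_apply, hb]
  have hli : LinearIndependent ℂ b := Fintype.linearIndependent_iff.2 fun c hc => by
    refine congrFun (eq_zero_of_sum_pow_eq_zero c fun z => ?_)
    rw [← hsum, hc, map_zero, Pi.zero_apply]
  have hsp : ⊤ ≤ Submodule.span ℂ (Set.range b) := fun v _ => by
    obtain ⟨c, hc⟩ := hs v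
    have e : v = ∑ j : Fin n, c j • b j :=
      hinj (funext fun z => by rw [hc, hsum (fun j => c j), Finset.sum_range])
    rw [e]
    exact Submodule.sum_mem _ fun j _ =>
      Submodule.smul_mem _ _ (Submodule.subset_span ⟨j, rfl⟩)
  exact ⟨.mk hli hsp, Module.Basis.coe_mk hli hsp⟩

/-- The coefficient in the frame `ζ_L dz` as a linear map. -/
def coefNLinear (E : HolLine) : H10 E →ₗ[ℂ] ℂ → ℂ where
  toFun φ := coefN φ.1
  map_add' _ _ := rfl
  map_smul' _ _ := rfl

theorem exists_basis_H10 {k : ℕ} (hk : 2 ≤ k) :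
    ∃ β : Module.Basis (Fin (k - 1)) ℂ (H10 (lineOfDegree k)),
      ∀ (j : Fin (k - 1)) (z : ℂ), coefN (β j).1 z = z ^ (j : ℕ) := by
  obtain ⟨β, hβ⟩ := exists_basis_of_eval_eq_pow (coefNLinear (lineOfDegree k))
    (fun φ ψ h => Subtype.ext (form_ext h))
    (fun j : Fin (k - 1) => monomialForm k j (by omega)) (fun _ _ => rfl)
    (exists_coefN_eq_sum hk)
  exact ⟨β, fun j z => by rw [hβ, coefN_monomialForm]⟩

/-! ### Duality and antiholomorphic representatives. -/

theorem bijective_antiClass {k n : ℕ} (hk : 1 ≤ k)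
    (β : Module.Basis (Fin n) ℂ (H10 (lineOfDegree k))) (H : HermMetric (lineOfDegree k)) :
    Function.Bijective (antiClass H) ∧
      Function.Bijective (LinearMap.pi fun i => couplingClasses (lineOfDegree k) (β i)) :=
  bijective_of_pairing (V := H10 (lineOfDegree k)) (W := H01 (lineOfDegree k).dual) β
    (couplingClasses (lineOfDegree k)) (eq_zero_of_couplingClasses_eq_zero hk)
    (antiClass (E := lineOfDegree k) H)
    (eq_zero_of_couplingClasses_antiClass (E := lineOfDegree k) H)

/-- Antiholomorphic forms correspond to holomorphic ones under `hPredual` and `hDual`, so existence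
and uniqueness are surjectivity and injectivity of `antiClass H`. -/
theorem existsUnique_antiholomorphic {E : HolLine} (H : HermMetric E)
    (hb : Function.Bijective (antiClass H)) (c : H01 E.dual) :
    ∃! η : Form 0 1 E.dual, cls η = c ∧ IsAntiholomorphic H.dual η := by
  obtain ⟨φ, rfl⟩ := hb.2 c
  refine ⟨hPredual H φ.1, ⟨rfl, ?_⟩, ?_⟩
  · rw [isAntiholomorphic_iff, hDual_hPredual]
    exact φ.2
  · rintro η ⟨hη, ha⟩
    have h1 : antiClass H ⟨hDual H η, (isAntiholomorphic_iff H η).1 ha⟩ = antiClass H φ := by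
      rw [← hη]
      exact congrArg cls (hPredual_hDual H η)
    rw [← hb.1 h1, hPredual_hDual]

/-! ### Evaluation of the integrals `b_j`. -/

theorem roundFactor_pos (z : ℂ) : 0 < roundFactor z := by
  have := Real.pi_pos
  unfold roundFactor
  positivity

theorem continuous_roundFactor : Continuous roundFactor := by
  unfold roundFactor
  refine continuous_const.div (by fun_prop) fun z => ?_
  have := Real.pi_pos
  positivity

/-- All dependence on the metric cancels, by `|a|²/ā = a`. At zeros of `a` division by zero gives 0,
which agrees with the right-hand side. -/
theorem roundFactor_smul_bIntegrand {E : HolLine} (H : HermMetric E) (η : Form 0 1 E.dual)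
    (j : ℕ) (z : ℂ) :
    (ENNReal.ofReal (roundFactor z)).toReal • bIntegrand H η (j + 1) z =
      2 * (z ^ j * coefN η z) := by
  have hρ := roundFactor_pos z
  have hρ' : (roundFactor z : ℂ) ≠ 0 := by exact_mod_cast hρ.ne'
  rw [ENNReal.toReal_ofReal hρ.le, Complex.real_smul, bIntegrand, normSq, normSqDz, coefN_hDual]
  by_cases h : coefN η z = 0
  · simp [h]
  have hh : (H.hN z : ℂ) ≠ 0 := by exact_mod_cast (H.posN z).ne'
  have hc : conj (coefN η z) ≠ 0 := (map_ne_zero _).2 h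
  -- This includes `z = 0`, where both sides are 1 for `j = 0` and 0 otherwise.
  have hz : z⁻¹ ^ (-((j + 1 : ℕ) : ℤ) + 1) = z ^ j := by
    have e : -((j + 1 : ℕ) : ℤ) + 1 = -(j : ℤ) := by push_cast; ring
    rw [e, inv_zpow', neg_neg, zpow_natCast]
  rw [hz]
  have hn : ((‖coefN η z‖ : ℂ)) ^ 2 = coefN η z * conj (coefN η z) := by
    rw [Complex.mul_conj, Complex.normSq_eq_norm_sq]
    push_cast
    ring
  simp only [HermMetric.dual]
  push_cast
  rw [hn]
  field_simp

theorem integrable_bIntegrand_and_bCoeff_eq {E : HolLine} (H : HermMetric E)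
    (η : Form 0 1 E.dual) (φ : H10 E) (j : ℕ) (hφ : ∀ z, coefN φ.1 z = z ^ j) :
    Integrable (bIntegrand H η (j + 1)) areaMeasure ∧
      bCoeff H η (j + 1) = couplingClasses E φ (cls η) := by
  have hm : Measurable fun z => ENNReal.ofReal (roundFactor z) :=
    continuous_roundFactor.measurable.ennreal_ofReal
  have hfin : ∀ᵐ z : ℂ, ENNReal.ofReal (roundFactor z) < ⊤ :=
    ae_of_all _ fun _ => ENNReal.ofReal_lt_top
  constructor
  · rw [areaMeasure, integrable_withDensity_iff_integrable_smul' hm hfin]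
    simp only [roundFactor_smul_bIntegrand, ← hφ]
    exact (integrable_coefN_mul φ.1 η).const_mul 2
  · rw [bCoeff, areaMeasure, integral_withDensity_eq_integral_toReal_smul hm hfin,
      couplingClasses_cls, coupling_eq, ← integral_const_mul]
    simp only [roundFactor_smul_bIntegrand, ← hφ]

end SphereLine

open SphereLine
theorem mainTheorem10 (k : ℕ) (hk : 2 ≤ k) :
    -- the basis `β = {z^{j-1} ζ_L dz}` of `H^{1,0}(L)`; `j : Fin (k - 1)` stands for `j + 1`
    ∃ β : Module.Basis (Fin (k - 1)) ℂ (H10 (lineOfDegree k)),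
      (∀ (j : Fin (k - 1)) (z : ℂ), coefN (β j).1 z = z ^ (j : ℕ)) ∧
    -- the coupling descends to cohomology classes
    ∃ P : H10 (lineOfDegree k) →ₗ[ℂ] H01 (lineOfDegree k).dual →ₗ[ℂ] ℂ,
      (∀ (φ : H10 (lineOfDegree k)) (η : Form 0 1 (lineOfDegree k).dual),
        P φ (cls η) = coupling φ.1 η) ∧
    -- the dual basis of `H^{0,1}(L*)`
    ∃ βdual : Module.Basis (Fin (k - 1)) ℂ (H01 (lineOfDegree k).dual),
      (∀ i j : Fin (k - 1), P (β i) (βdual j) = if i = j then 1 else 0) ∧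
    -- each class has exactly one antiholomorphic representative for each metric, and the
    -- coefficients computed from it are the coordinates of the class
      (∀ (c : H01 (lineOfDegree k).dual) (H : HermMetric (lineOfDegree k)),
        (∃! η : Form 0 1 (lineOfDegree k).dual, cls η = c ∧ IsAntiholomorphic H.dual η) ∧
        ∀ η : Form 0 1 (lineOfDegree k).dual, cls η = c → IsAntiholomorphic H.dual η →
          ∀ j : Fin (k - 1),
            MeasureTheory.Integrable (bIntegrand H η (j + 1)) areaMeasure ∧
            bCoeff H η (j + 1) = βdual.repr c j) ∧
    -- the coefficients do not depend on the metric
      (∀ (H H' : HermMetric (lineOfDegree k)) (η η' : Form 0 1 (lineOfDegree k).dual),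
        cls η = cls η' → IsAntiholomorphic H.dual η → IsAntiholomorphic H'.dual η' →
          ∀ j : Fin (k - 1), bCoeff H η (j + 1) = bCoeff H' η' (j + 1)) := by
  obtain ⟨β, hβ⟩ := exists_basis_H10 hk
  have hk1 : 1 ≤ k := by omega
  have hbij := fun H : HermMetric (lineOfDegree k) => bijective_antiClass hk1 β H
  -- The coordinate map involves no metric, but its bijectivity is proved through one; the
  -- Fubini–Study metric supplies it.
  obtain ⟨βd, hdual, hrepr⟩ := exists_dual_basis (V := H10 (lineOfDegree k))
    (W := H01 (lineOfDegree k).dual) β (couplingClasses (lineOfDegree k))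
    (hbij (fubiniStudy k)).2
  have hb := fun (H : HermMetric (lineOfDegree k)) η (j : Fin (k - 1)) =>
    integrable_bIntegrand_and_bCoeff_eq H η (β j) j (hβ j)
  refine ⟨β, hβ, couplingClasses _, couplingClasses_cls, βd, hdual, fun c H =>
    ⟨existsUnique_antiholomorphic H (hbij H).1 c, ?_⟩, ?_⟩
  · rintro η rfl - j
    exact ⟨(hb H η j).1, (hb H η j).2.trans (hrepr _ j).symm⟩
  · intro H H' η η' h _ _ j
    rw [(hb H η j).2, (hb H' η' j).2, h]
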